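/- **Setting.** Let $L>0$, $0<\lambda<1$, $D^\pm>0$, $T>0$, $\Omega=(-L,L)$, $\Omega_1=(-L,0)$, $\Omega_2=(0,L)$, and set $$c^+=\frac{\lambda}{D^+},\quad c^-=\frac{1-\lambda}{D^-},\quad \kappa^+=\frac{\lambda}{2},\quad \kappa^-=\frac{1-\lambda}{2},$$ with $c(x)=c^\pm$, $\kappa(x)=\kappa^\pm$ for $\pm x>0$. For $k\ge 1$ let $H^{k,0}(\Omega)$ be the set of $v\in L^2(\Omega)$ with $v\in H^k(\Omega_1)\cap H^k(\Omega_2)$, $v(0^+)=v(0^-)$ and, if $k\ge 2$, $\kappa^+v'(0^+)=\kappa^-v'(0^-)$; let $H^{k,0}_0(\Omega)$ be the subspace of those $v$ with $v(-L)=v(L)=0$ (so $H_0^{1,0}(\Omega)=H_0^1(\Omega)$ and $H_0^{2,0}(\Omega)=H^{2,0}(\Omega)\cap H^1_0(\Omega)$), and put $|v|_{H^{2,0}(\Omega)}^2=\|v''\|_{L^2(\Omega_1)}^2+\|v''\|_{L^2(\Omega_2)}^2$. Let $(\cdot,\cdot)$ be the $L^2(\Omega)$ inner product and $\mathcal L(w,v)=\int_{\Omega_1}\kappa^-w'v'\,dx+\int_{\Omega_2}\kappa^+w'v'\,dx$.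 **Exact solution.** Let $u\in W^{3,1}(0,T;L^2(\Omega))$ with $u(t)\in H^{2,0}(\Omega)\cap H^1_0(\Omega)$ for all $t\in[0,T]$ and $\partial_tu,\ \partial_t^2u\in L^1(0,T;H^{2,0}(\Omega))$ satisfy $$(c\,\partial_tu(t),v)+\mathcal L(u(t),v)=0\qquad\text{for all } v\in H_0^{1,0}(\Omega),\ t\in(0,T].$$ **Discretization.** Let $N,M\ge 1$, $h=2L/N$, $x_i=-L+ih$, $\Delta t=T/M$, $t_k=k\Delta t$. Let $S_h$ be the linear immersed finite element space: the span of $\phi_1,\dots,\phi_{N-1}$, where $\phi_i$ is continuous, $\phi_i(x_j)=\delta_{ij}$, $\phi_i$ is affine on each element $[x_j,x_{j+1}]$ that does not contain $0$ in its interior, and on the element with $x_j<0<x_{j+1}$ (if there is one) it is affine on each side of $0$ with $\kappa^+\phi_i'(0^+)=\kappa^-\phi_i'(0^-)$. Let $u_h^0,\dots,u_h^M\in S_h$ satisfy the Crank–Nicolson scheme $$\Big(c\,\frac{u_h^k-u_h^{k-1}}{\Delta t},v_h\Big)+\mathcal L\Big(\frac{u_h^k+u_h^{k-1}}{2},v_h\Big)=0\qquad\text{for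 all } v_h\in S_h,\ 1\le k\le M,$$ the starting value $u_h^0\in S_h$ being arbitrary. **Constants.** Let $$\rho=\max\Big\{\frac{\kappa^-}{\kappa^+},\frac{\kappa^+}{\kappa^-}\Big\},\quad \alpha_3=\frac{\max\{\sqrt{c^+},\sqrt{c^-}\}}{\min\{\sqrt{c^+},\sqrt{c^-}\}},\quad \alpha_4=\max_{0\le\ell\le \max\{M,2\}-1}\alpha_3^\ell,\quad \alpha_5=\frac{\max\{\sqrt{\kappa^+},\sqrt{\kappa^-}\}}{\min\{\sqrt{c^+},\sqrt{c^-}\}}.$$ **Theorem.** There is an absolute constant $C>0$ (independent of $L,\lambda,D^\pm,T,N,M,u$ and $(u_h^k)$) such that, in this setting, for $A=\alpha_3^M$, and, if $T\ge 1$, also for $A=\alpha_3^T$, $$\begin{aligned}\max_{0\le k\le M}\|u(t_k)-u_h^k\|_{L^2(\Omega)}\le{}& C\rho h^2\Big(A\max_{0\le k\le M}|u(t_k)|_{H^{2,0}(\Omega)}+\alpha_4\int_0^T|\partial_tu(s)|_{H^{2,0}(\Omega)}\,ds\Big)\\&+\alpha_4\frac{\Delta t^2}{2}\Big(\frac14\int_0^T\|\partial_t^3u(s)\|_{L^2(\Omega)}\,ds+\alpha_5\int_0^T|\partial_t^2u(s)|_{H^{2,0}(\Omega)}\,ds\Big)\\&+A\,\|u(0)-u_h^0\|_{L^2(\Omega)}.\end{aligned}$$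 -/

import Mathlib

open MeasureTheory Set Filter Topology

noncomputable section

namespace InterfaceIFEM

/-! ### Weak derivatives and Sobolev spaces on an interval -/

/-- `w` is a weak derivative of order `k` of `v` on the open interval `(a, b)`. -/
def IsWeakDeriv (k : ℕ) (a b : ℝ) (v w : ℝ → ℝ) : Prop :=
  ∀ φ : ℝ → ℝ, ContDiff ℝ (⊤ : ℕ∞) φ → HasCompactSupport φ → tsupport φ ⊆ Ioo a b →
    ∫ x in Ioo a b, v x * iteratedDeriv k φ x = (-1 : ℝ) ^ k * ∫ x in Ioo a b, w x * φ x

/-- `v` has a weak derivative of order `k` in `L²(a, b)`. -/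
def HasL2WeakDeriv (k : ℕ) (a b : ℝ) (v : ℝ → ℝ) : Prop :=
  ∃ w : ℝ → ℝ, MemLp w 2 (volume.restrict (Ioo a b)) ∧ IsWeakDeriv k a b v w

/-- The Sobolev space `H^k(a, b)`. -/
def MemH (k : ℕ) (a b : ℝ) (v : ℝ → ℝ) : Prop :=
  MemLp v 2 (volume.restrict (Ioo a b)) ∧ ∀ j : ℕ, 1 ≤ j → j ≤ k → HasL2WeakDeriv j a b v

open Classical in
/-- The weak derivative of order `k` in `L²(a, b)` (unique up to null sets), zero if there is
none. -/
def weakDeriv (k : ℕ) (a b : ℝ) (v : ℝ → ℝ) : ℝ → ℝ :=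
  if h : HasL2WeakDeriv k a b v then h.choose else 0

/-- The trace of `v` at `a` from the right is `l`: the essential one-sided limit, which for an
`H¹` function is the one-sided limit of its continuous representative. -/
def HasTraceRight (v : ℝ → ℝ) (a l : ℝ) : Prop :=
  Tendsto v (𝓝[>] a ⊓ ae volume) (𝓝 l)

/-- The trace of `v` at `a` from the left is `l`. -/
def HasTraceLeft (v : ℝ → ℝ) (a l : ℝ) : Prop :=
  Tendsto v (𝓝[<] a ⊓ ae volume) (𝓝 l)

/-! ### The data of the interface problem -/

/-- The domain `(-L, L)`, the interface parameter `lam = λ ∈ (0, 1)` and the diffusion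
coefficients `Dp = D⁺` (on the right of `0`) and `Dm = D⁻` (on the left of `0`). -/
structure Data where
  L : ℝ
  lam : ℝ
  Dp : ℝ
  Dm : ℝ
  L_pos : 0 < L
  lam_pos : 0 < lam
  lam_lt_one : lam < 1
  Dp_pos : 0 < Dp
  Dm_pos : 0 < Dm

namespace Data

variable (P : Data)

/-- `c⁺ = λ / D⁺`. -/
def cp : ℝ := P.lam / P.Dp

/-- `c⁻ = (1 - λ) / D⁻`. -/
def cm : ℝ := (1 - P.lam) / P.Dm

/-- `κ⁺ = λ / 2`. -/
def kp : ℝ := P.lam / 2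

/-- `κ⁻ = (1 - λ) / 2`. -/
def km : ℝ := (1 - P.lam) / 2

/-- The function `c`; its value at the interface `0` plays no role. -/
def c (x : ℝ) : ℝ := if 0 < x then P.cp else P.cm

/-- Lebesgue measure on `Ω = (-L, L)`. -/
def vol : Measure ℝ := volume.restrict (Ioo (-P.L) P.L)

/-- The Hilbert space `L²(Ω)`. -/
abbrev L2 : Type := Lp ℝ 2 P.vol

/-- The norm of `L²(Ω)`, on functions. -/
def l2norm (v : ℝ → ℝ) : ℝ := (eLpNorm v 2 P.vol).toReal

/-- The broken space `H^{k,0}(Ω)`: functions in `L²(Ω)` that are `H^k` on `(-L, 0)` and on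
`(0, L)`, with `[v] = 0` at the interface if `k ≥ 1`, and `[κ ∂ₓ v] = 0` if `k ≥ 2`
(for `k = 1` the derivative has no trace). -/
structure MemBroken (k : ℕ) (v : ℝ → ℝ) : Prop where
  memLp : MemLp v 2 P.vol
  left : MemH k (-P.L) 0 v
  right : MemH k 0 P.L v
  jump : 1 ≤ k → ∃ l : ℝ, HasTraceLeft v 0 l ∧ HasTraceRight v 0 l
  flux : 2 ≤ k → ∃ q : ℝ,
    HasTraceLeft (fun x => P.km * weakDeriv 1 (-P.L) 0 v x) 0 q ∧
    HasTraceRight (fun x => P.kp * weakDeriv 1 0 P.L v x) 0 q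

/-- The space `H_0^{k,0}(Ω)`: functions of `H^{k,0}(Ω)` vanishing at `-L` and at `L`. -/
structure MemBrokenZero (k : ℕ) (v : ℝ → ℝ) : Prop where
  memBroken : P.MemBroken k v
  bdry_left : HasTraceRight v (-P.L) 0
  bdry_right : HasTraceLeft v P.L 0

/-- The seminorm `|v|_{H^{2,0}(Ω)}`. -/
def semiH2 (v : ℝ → ℝ) : ℝ :=
  Real.sqrt ((∫ x in Ioo (-P.L) 0, weakDeriv 2 (-P.L) 0 v x ^ 2) +
    ∫ x in Ioo 0 P.L, weakDeriv 2 0 P.L v x ^ 2)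

/-- The weighted product `(c w, v) = ∫_Ω c w v dx`. -/
def massForm (w v : ℝ → ℝ) : ℝ := ∫ x, P.c x * w x * v x ∂P.vol

/-- The bilinear form `𝓛(w, v) = ∫_Ω κ ∂ₓw ∂ₓv dx`. -/
def stiffForm (w v : ℝ → ℝ) : ℝ :=
  (∫ x in Ioo (-P.L) 0, P.km * weakDeriv 1 (-P.L) 0 w x * weakDeriv 1 (-P.L) 0 v x) +
    ∫ x in Ioo 0 P.L, P.kp * weakDeriv 1 0 P.L w x * weakDeriv 1 0 P.L v x

/-! ### The weak solution -/

/-- `u ∈ W^{1,1}(0, T; L²(Ω))` is given by its absolutely continuous representative on `[0, T]`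
and `w = ∂ₜ u` (Bochner integral). -/
def IsTimeDeriv (T : ℝ) (u w : ℝ → P.L2) : Prop :=
  IntervalIntegrable w volume 0 T ∧ ∀ t ∈ Icc 0 T, u t = u 0 + ∫ s in (0 : ℝ)..t, w s

/-- `v ∈ L¹(0, T; H^{2,0}(Ω))`. -/
def MemL1H2 (T : ℝ) (v : ℝ → P.L2) : Prop :=
  (∀ᵐ s ∂volume.restrict (Ioc 0 T), P.MemBroken 2 (v s)) ∧
    IntervalIntegrable (fun s => P.semiH2 (v s)) volume 0 T

/-- `u` is a solution of the variational interface problem on `[0, T]` with time derivatives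
`u₁ = ∂ₜu`, `u₂ = ∂ₜ²u`, `u₃ = ∂ₜ³u`, of the regularity needed for the error bound to make
sense: `u ∈ W^{3,1}(0,T;L²)`, `u(t) ∈ H^{2,0} ∩ H^1_0`, and `∂ₜu, ∂ₜ²u ∈ L¹(0,T;H^{2,0})`. -/
structure IsWeakSolution (T : ℝ) (u u₁ u₂ u₃ : ℝ → P.L2) : Prop where
  deriv_one : P.IsTimeDeriv T u u₁
  deriv_two : P.IsTimeDeriv T u₁ u₂
  deriv_three : P.IsTimeDeriv T u₂ u₃
  mem : ∀ t ∈ Icc 0 T, P.MemBrokenZero 2 (u t)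
  mem_one : P.MemL1H2 T u₁
  mem_two : P.MemL1H2 T u₂
  weak_eq : ∀ t ∈ Ioc 0 T, ∀ v : ℝ → ℝ, P.MemBrokenZero 1 v →
    P.massForm (u₁ t) v + P.stiffForm (u t) v = 0

/-! ### The immersed finite element space -/

/-- The mesh size `h = 2L / N`. -/
def h (N : ℕ) : ℝ := 2 * P.L / N

/-- The `i`-th node `x_i = -L + i h`. -/
def node (N : ℕ) (i : ℤ) : ℝ := -P.L + i * P.h N

/-- The primitive `∫_0^x ds / κ(s)`. A function that is affine in `y` on an element is piecewise
linear there, continuous, and has continuous flux `κ v'`. -/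
def y (x : ℝ) : ℝ := if 0 < x then x / P.kp else x / P.km

/-- The immersed nodal basis function `φ_i`: on every element it is affine in `y`, it is `1` at
`x_i` and `0` at all the other nodes. On elements without the interface in their interior it is
the usual linear hat function; on the element `x_j < 0 < x_{j+1}` it is linear on each side of
`0` with `[φ_i] = 0` and `[κ φ_i'] = 0`. -/
def phi (N : ℕ) (i : ℤ) (x : ℝ) : ℝ :=
  max 0 (min
    ((P.y x - P.y (P.node N (i - 1))) / (P.y (P.node N i) - P.y (P.node N (i - 1))))
    ((P.y (P.node N (i + 1)) - P.y x) / (P.y (P.node N (i + 1)) - P.y (P.node N i))))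

/-- The immersed finite element space `S_h = span {φ_1, …, φ_{N-1}}`. -/
def Sh (N : ℕ) : Submodule ℝ (ℝ → ℝ) :=
  Submodule.span ℝ (P.phi N '' {i : ℤ | 1 ≤ i ∧ i ≤ N - 1})

/-- `uh 0, …, uh M` solve the Crank–Nicolson scheme with time step `dt`. The starting
value `uh 0` is any element of `S_h`. -/
structure IsCrankNicolson (N M : ℕ) (dt : ℝ) (uh : ℕ → ℝ → ℝ) : Prop where
  mem : ∀ k ≤ M, uh k ∈ P.Sh N
  step : ∀ k : ℕ, 1 ≤ k → k ≤ M → ∀ v ∈ P.Sh N,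
    P.massForm (fun x => (uh k x - uh (k - 1) x) / dt) v +
      P.stiffForm (fun x => (uh k x + uh (k - 1) x) / 2) v = 0

/-! ### The constants and the error bound -/

/-- `ρ = max {κ⁻/κ⁺, κ⁺/κ⁻}`. -/
def rho : ℝ := max (P.km / P.kp) (P.kp / P.km)

/-- `α₃ = max {√c⁺, √c⁻} / min {√c⁺, √c⁻}`. -/
def alpha3 : ℝ := max (Real.sqrt P.cp) (Real.sqrt P.cm) / min (Real.sqrt P.cp) (Real.sqrt P.cm)

/-- `α₅ = max {√κ⁺, √κ⁻} / min {√c⁺, √c⁻}`. -/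
def alpha5 : ℝ := max (Real.sqrt P.kp) (Real.sqrt P.km) / min (Real.sqrt P.cp) (Real.sqrt P.cm)

/-- The maximum of `f 0, …, f n`. -/
def maxUpTo (n : ℕ) (f : ℕ → ℝ) : ℝ :=
  (Finset.range (n + 1)).sup' ⟨0, Finset.mem_range.2 n.succ_pos⟩ f

/-- `α₄`, the maximum of `α₃^ℓ` over `0 ≤ ℓ ≤ M - 1` (over `0 ≤ ℓ ≤ 1` if `M = 1`). -/
def alpha4 (M : ℕ) : ℝ := maxUpTo (max M 2 - 1) fun l => P.alpha3 ^ l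

/-- The right-hand side of the error estimate, with `A` in the place of the power of `α₃` that
multiplies the spatial and the initial term, and `e₀` the initial error. -/
def errorBound (C A T : ℝ) (N M : ℕ) (u u₁ u₂ u₃ : ℝ → P.L2) (e₀ : ℝ) : ℝ :=
  C * P.rho * P.h N ^ 2 *
      (A * maxUpTo M (fun k => P.semiH2 (u (k * (T / M)))) +
        P.alpha4 M * ∫ s in (0 : ℝ)..T, P.semiH2 (u₁ s)) +
    P.alpha4 M * ((T / M) ^ 2 / 2) *
      (1 / 4 * (∫ s in (0 : ℝ)..T, ‖u₃ s‖) +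
        P.alpha5 * ∫ s in (0 : ℝ)..T, P.semiH2 (u₂ s)) +
    A * e₀

end Data

end InterfaceIFEM

end

noncomputable section

namespace InterfaceIFEM

/-! ### Primitives on an interval -/

/-! In one space dimension the nodal interpolant in `S_h` is the Ritz projection. A finite element
function has constant flux `κ W'` on every element, including the one cut by the interface, so `∫ κ
E' W'` over an element is that constant times the increment of `E`, and it vanishes when `E` is zero
at the nodes (`IsElementwise.integral_eq_zero`). Hence `θ^k = I u(t_k) - u_h^k` satisfies the
Crank–Nicolson equation with only a mass-form residual `r = (I u(t_k) - I u(t_{k-1})) -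
(Δt/2)(∂ₜu(t_k) + ∂ₜu(t_{k-1}))`.

Testing with `θ^k + θ^{k-1}`, the stiffness term has a sign and the mass term is a difference of
squares, so the `c`-weighted norm of `θ` grows by at most that of `r` in each step
(`wnorm_step_le`). The residual is the trapezoidal error of `u`, bounded by the Peano kernel
(`norm_trapezoid_le`), minus the interpolation error of the increment `u(t_k) - u(t_{k-1})`. For the
interpolation error `E` on an element, `κ E'` is the flux of `u` minus a constant; since `E'` has
mean zero, `κ E'` is bounded by the variation of the flux, which gives the constant `ρ h²`
(`integral_sq_le_of_element`). The broken seminorm of the increment is at most the time integral of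
that of `∂ₜu`, by duality with a dense space of test functions (`sqrt_integral_sq_sub_le`).

All steps are summed in the weighted norm, so passing from `L²` to it and back costs a single factor
`α₃`. As `α₃ ≥ 1`, this factor is below `α₃^M`, below `α₃^T` when `T ≥ 1`, and below `α₄`. The
interpolation error at `t_k` and the one hidden in `θ^0` give `C = 2`; the `α₅` term of the bound
enters only through its sign.

The remaining work translates weak derivatives, traces and broken spaces into absolutely continuous
representatives (`HasGrad`, `HasFlux`). -/

/-- On `[a, b]` the function `F` is a primitive of the integrable function `f`. -/
structure IsPrimitiveOn (a b : ℝ) (F f : ℝ → ℝ) : Prop where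
  integrable : IntervalIntegrable f volume a b
  eq : ∀ x ∈ Icc a b, F x = F a + ∫ s in a..x, f s

namespace IsPrimitiveOn

variable {a b : ℝ} {F f G g : ℝ → ℝ}

theorem integrable_sub (h : IsPrimitiveOn a b F f) {x y : ℝ} (hx : x ∈ Icc a b)
    (hy : y ∈ Icc a b) : IntervalIntegrable f volume x y :=
  h.integrable.mono_set (by
    rw [uIcc_of_le (hx.1.trans hx.2)]
    exact uIcc_subset_Icc hx hy)

theorem sub_eq (h : IsPrimitiveOn a b F f) {x y : ℝ} (hx : x ∈ Icc a b) (hy : y ∈ Icc a b) :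
    F y - F x = ∫ s in x..y, f s := by
  have ha : a ∈ Icc a b := ⟨le_rfl, hx.1.trans hx.2⟩
  rw [h.eq x hx, h.eq y hy,
    ← intervalIntegral.integral_add_adjacent_intervals (h.integrable_sub ha hx)
      (h.integrable_sub hx hy)]
  ring

theorem mono (h : IsPrimitiveOn a b F f) {c d : ℝ} (hc : c ∈ Icc a b) (hd : d ∈ Icc a b) :
    IsPrimitiveOn c d F f where
  integrable := h.integrable_sub hc hd
  eq x hx := by
    rw [← h.sub_eq hc ⟨hc.1.trans hx.1, hx.2.trans hd.2⟩]
    ring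

theorem sub (hF : IsPrimitiveOn a b F f) (hG : IsPrimitiveOn a b G g) :
    IsPrimitiveOn a b (fun x => F x - G x) (fun x => f x - g x) where
  integrable := hF.integrable.sub hG.integrable
  eq x hx := by
    have ha : a ∈ Icc a b := ⟨le_rfl, hx.1.trans hx.2⟩
    rw [intervalIntegral.integral_sub (hF.integrable_sub ha hx) (hG.integrable_sub ha hx),
      hF.eq x hx, hG.eq x hx]
    ring

theorem add (hF : IsPrimitiveOn a b F f) (hG : IsPrimitiveOn a b G g) :
    IsPrimitiveOn a b (fun x => F x + G x) (fun x => f x + g x) where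
  integrable := hF.integrable.add hG.integrable
  eq x hx := by
    have ha : a ∈ Icc a b := ⟨le_rfl, hx.1.trans hx.2⟩
    rw [intervalIntegral.integral_add (hF.integrable_sub ha hx) (hG.integrable_sub ha hx),
      hF.eq x hx, hG.eq x hx]
    ring

theorem const_mul (r : ℝ) (hF : IsPrimitiveOn a b F f) :
    IsPrimitiveOn a b (fun x => r * F x) (fun x => r * f x) where
  integrable := hF.integrable.const_mul r
  eq x hx := by
    rw [intervalIntegral.integral_const_mul, hF.eq x hx]
    ring

theorem of_contDiff (a b : ℝ) (hF : ContDiff ℝ (⊤ : ℕ∞) F) : IsPrimitiveOn a b F (deriv F) where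
  integrable := (hF.continuous_deriv (by simp)).intervalIntegrable _ _
  eq x _ := by
    rw [intervalIntegral.integral_deriv_eq_sub
      (fun y _ => (hF.differentiable (by simp)).differentiableAt)
      ((hF.continuous_deriv (by simp)).intervalIntegrable _ _)]
    ring

theorem continuousOn (h : IsPrimitiveOn a b F f) (hab : a ≤ b) : ContinuousOn F (Icc a b) := by
  have h1 := intervalIntegral.continuousOn_primitive_interval' h.integrable
    (left_mem_uIcc (a := a) (b := b))
  rw [uIcc_of_le hab] at h1
  exact (continuousOn_const.add h1).congr h.eq

/-- Integration by parts for primitives of integrable functions. -/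
theorem integral_mul (hF : IsPrimitiveOn a b F f) (hG : IsPrimitiveOn a b G g) (hab : a ≤ b) :
    ∫ x in a..b, F x * g x = F b * G b - F a * G a - ∫ x in a..b, f x * G x := by
  -- `F` is unconstrained outside `[a, b]`, so its derivative at the endpoints means nothing. The
  -- formula `F a + ∫ f` is used in its place: it is absolutely continuous and agrees with `F` on
  -- `[a, b]`.
  have key : ∀ {F f : ℝ → ℝ}, IsPrimitiveOn a b F f →
      AbsolutelyContinuousOnInterval (fun x => F a + ∫ s in a..x, f s) a b ∧
      ∀ᵐ x, x ∈ uIcc a b → deriv (fun x => F a + ∫ s in a..x, f s) x = f x := by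
    intro F f h
    constructor
    · exact AbsolutelyContinuousOnInterval.add
        ((contDiff_const (n := 1)).contDiffOn.absolutelyContinuousOnInterval)
        (h.integrable.absolutelyContinuousOnInterval_intervalIntegral left_mem_uIcc)
    · filter_upwards [h.integrable.ae_hasDerivAt_integral] with x hx hxab
      exact ((hx hxab a left_mem_uIcc).const_add _).deriv
  have hb : b ∈ Icc a b := ⟨hab, le_rfl⟩
  have ha : a ∈ Icc a b := ⟨le_rfl, hab⟩
  have h1 := (key hF).1.integral_mul_deriv_eq_deriv_mul (key hG).1
  rw [← hF.eq b hb, ← hG.eq b hb] at h1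
  simp only [intervalIntegral.integral_same, add_zero] at h1
  have e1 : ∫ x in a..b, (F a + ∫ s in a..x, f s) * deriv (fun x => G a + ∫ s in a..x, g s) x
      = ∫ x in a..b, F x * g x := by
    apply intervalIntegral.integral_congr_ae
    filter_upwards [(key hG).2] with x hx hxab
    rw [hx (uIoc_subset_uIcc hxab), hF.eq x]
    rw [uIoc_of_le hab] at hxab
    exact ⟨hxab.1.le, hxab.2⟩
  have e2 : ∫ x in a..b, deriv (fun x => F a + ∫ s in a..x, f s) x * (G a + ∫ s in a..x, g s)
      = ∫ x in a..b, f x * G x := by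
    apply intervalIntegral.integral_congr_ae
    filter_upwards [(key hF).2] with x hx hxab
    rw [hx (uIoc_subset_uIcc hxab), hG.eq x]
    rw [uIoc_of_le hab] at hxab
    exact ⟨hxab.1.le, hxab.2⟩
  rw [e1, e2] at h1
  exact h1

end IsPrimitiveOn

/-! ### Weak derivatives -/

theorem setIntegral_Ioo_eq_intervalIntegral {a b : ℝ} (hab : a ≤ b) (f : ℝ → ℝ) :
    ∫ x in Ioo a b, f x = ∫ x in a..b, f x := by
  rw [intervalIntegral.integral_of_le hab, integral_Ioc_eq_integral_Ioo]

theorem intervalIntegrable_of_integrableOn_Ioo {a b : ℝ} (hab : a ≤ b) {f : ℝ → ℝ}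
    (hf : IntegrableOn f (Ioo a b)) : IntervalIntegrable f volume a b := by
  rwa [intervalIntegrable_iff_integrableOn_Ioo_of_le hab]

/-- A primitive of `w` has the weak derivative `w`. -/
theorem IsPrimitiveOn.isWeakDeriv {a b : ℝ} (hab : a ≤ b) {V v w : ℝ → ℝ}
    (h : IsPrimitiveOn a b V w) (hv : v =ᵐ[volume.restrict (Ioo a b)] V) :
    IsWeakDeriv 1 a b v w := by
  intro φ hφ _ hs
  have h1 : ∫ x in Ioo a b, v x * iteratedDeriv 1 φ x = ∫ x in Ioo a b, V x * deriv φ x := by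
    apply integral_congr_ae
    filter_upwards [hv] with x hx
    rw [hx, iteratedDeriv_one]
  have hz : ∀ x, x ∉ Ioo a b → φ x = 0 := fun x hx =>
    image_eq_zero_of_notMem_tsupport fun hx' => hx (hs hx')
  rw [h1, setIntegral_Ioo_eq_intervalIntegral hab, setIntegral_Ioo_eq_intervalIntegral hab,
    h.integral_mul (IsPrimitiveOn.of_contDiff a b hφ) hab, hz a (by simp), hz b (by simp)]
  ring

/-- A locally integrable function that integrates to zero against all test functions vanishes. -/
theorem ae_eq_zero_of_forall_test {a b : ℝ} {w : ℝ → ℝ} (hw : IntegrableOn w (Ioo a b))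
    (h : ∀ φ : ℝ → ℝ, ContDiff ℝ (⊤ : ℕ∞) φ → HasCompactSupport φ → tsupport φ ⊆ Ioo a b →
      ∫ x in Ioo a b, w x * φ x = 0) :
    w =ᵐ[volume.restrict (Ioo a b)] 0 := by
  have h1 := isOpen_Ioo.ae_eq_zero_of_integral_contDiff_smul_eq_zero (μ := volume)
    (hw.locallyIntegrableOn) (fun g hg hc hs => by
      rw [← h g hg hc hs, ← setIntegral_eq_integral_of_forall_compl_eq_zero (s := Ioo a b)]
      · simp [mul_comm]
      · intro x hx
        rw [image_eq_zero_of_notMem_tsupport fun hx' => hx (hs hx'), zero_smul])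
  exact (ae_restrict_iff' measurableSet_Ioo).2 h1

theorem integrable_mul_test {a b : ℝ} {w φ : ℝ → ℝ} (hw : IntegrableOn w (Ioo a b))
    (hφ : Continuous φ) (hc : HasCompactSupport φ) :
    IntegrableOn (fun x => w x * φ x) (Ioo a b) := by
  obtain ⟨C, hC⟩ := hφ.bounded_above_of_compact_support hc
  exact hw.mul_bdd hφ.aestronglyMeasurable (ae_of_all _ hC)

/-- Weak derivatives are unique. -/
theorem IsWeakDeriv.ae_eq {k : ℕ} {a b : ℝ} {v w₁ w₂ : ℝ → ℝ} (h₁ : IsWeakDeriv k a b v w₁)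
    (h₂ : IsWeakDeriv k a b v w₂) (hw₁ : IntegrableOn w₁ (Ioo a b))
    (hw₂ : IntegrableOn w₂ (Ioo a b)) : w₁ =ᵐ[volume.restrict (Ioo a b)] w₂ := by
  have h : (fun x => w₁ x - w₂ x) =ᵐ[volume.restrict (Ioo a b)] 0 := by
    refine ae_eq_zero_of_forall_test (hw₁.sub hw₂) fun φ hφ hc hs => ?_
    have e1 := h₁ φ hφ hc hs
    rw [h₂ φ hφ hc hs] at e1
    have e2 := mul_left_cancel₀ (pow_ne_zero k (by norm_num : (-1 : ℝ) ≠ 0)) e1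
    simp_rw [sub_mul]
    rw [integral_sub (integrable_mul_test hw₁ hφ.continuous hc)
      (integrable_mul_test hw₂ hφ.continuous hc), e2, sub_self]
  filter_upwards [h] with x hx
  exact sub_eq_zero.1 hx

/-- If no test function had integral one, rescaling shows that every test integral would vanish;
then the constant 1 would be zero almost everywhere on an interval of positive length. -/
theorem exists_test_integral_eq_one {a b : ℝ} (hab : a < b) :
    ∃ φ : ℝ → ℝ, ContDiff ℝ (⊤ : ℕ∞) φ ∧ HasCompactSupport φ ∧ tsupport φ ⊆ Ioo a b ∧
      ∫ x in Ioo a b, φ x = 1 := by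
  by_contra! hcon
  have h : (fun _ => (1 : ℝ)) =ᵐ[volume.restrict (Ioo a b)] 0 := by
    refine ae_eq_zero_of_forall_test (integrableOn_const (by simp)) fun φ hφ hc hs => ?_
    by_contra hne
    simp only [one_mul] at hne
    refine hcon (fun x => (∫ x in Ioo a b, φ x)⁻¹ * φ x) (contDiff_const.mul hφ) hc.mul_left
      ((tsupport_mul_subset_right).trans hs) ?_
    rw [integral_const_mul, inv_mul_cancel₀ hne]
  have h2 : volume.restrict (Ioo a b) = 0 := by
    rw [← ae_eq_bot, ← Filter.eventually_false_iff_eq_bot]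
    filter_upwards [h] with x hx
    simp at hx
  rw [Measure.restrict_eq_zero] at h2
  simp at h2
  linarith

/-- A test function with mean zero is the derivative of a test function. -/
theorem exists_test_deriv_eq {a b : ℝ} {χ : ℝ → ℝ} (hχ : ContDiff ℝ (⊤ : ℕ∞) χ)
    (hc : HasCompactSupport χ) (hs : tsupport χ ⊆ Ioo a b) (h0 : ∫ x in Ioo a b, χ x = 0) :
    ∃ φ : ℝ → ℝ, ContDiff ℝ (⊤ : ℕ∞) φ ∧ HasCompactSupport φ ∧ tsupport φ ⊆ Ioo a b ∧
      deriv φ = χ := by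
  rcases (tsupport χ).eq_empty_or_nonempty with he | hne
  · refine ⟨0, contDiff_const, HasCompactSupport.zero, by simp, ?_⟩
    rw [tsupport_eq_empty_iff.1 he]
    exact deriv_const' 0
  obtain ⟨m, hm, hm'⟩ := hc.isCompact.exists_isLeast hne
  obtain ⟨M, hM, hM'⟩ := hc.isCompact.exists_isGreatest hne
  have hz : ∀ x, x ∉ Icc m M → χ x = 0 := fun x hx =>
    image_eq_zero_of_notMem_tsupport fun hx' => hx ⟨hm' hx', hM' hx'⟩
  have ham := (hs hm).1
  have hMb := (hs hM).2
  have hmM : m ≤ M := hm' hM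
  have hab : a < b := by linarith
  have hcont := hχ.continuous
  have hd : ∀ x, HasDerivAt (fun x => ∫ s in a..x, χ s) (χ x) x := fun x =>
    intervalIntegral.integral_hasDerivAt_right (hcont.intervalIntegrable _ _)
      (hcont.stronglyMeasurableAtFilter _ _) hcont.continuousAt
  have hderiv : deriv (fun x => ∫ s in a..x, χ s) = χ := funext fun x => (hd x).deriv
  have hint : ∫ s in a..b, χ s = 0 := by rw [← setIntegral_Ioo_eq_intervalIntegral hab.le, h0]
  have hsup : Function.support (fun x => ∫ s in a..x, χ s) ⊆ Icc m M := by
    intro x hx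
    by_contra hx'
    apply hx
    -- Left of the support there is nothing to integrate; right of it the integral from `a` is the
    -- total integral, which is zero, minus an empty tail.
    rcases lt_or_ge x m with h | h
    · apply intervalIntegral.integral_zero_ae
      refine ae_of_all _ fun s hs' => hz s fun hs2 => ?_
      have := hs'.2
      have : s ≤ max a x := this
      have := max_lt ham h
      linarith [hs2.1]
    · have hxM : M < x := not_le.1 fun h' => hx' ⟨h, h'⟩
      have e := intervalIntegral.integral_add_adjacent_intervals
        (hcont.intervalIntegrable (μ := volume) a b) (hcont.intervalIntegrable b x)
      rw [hint, zero_add] at e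
      change ∫ s in a..x, χ s = 0
      rw [← e]
      apply intervalIntegral.integral_zero_ae
      refine ae_of_all _ fun s hs' => hz s fun hs2 => ?_
      have : min b x < s := hs'.1
      have := lt_min hMb hxM
      linarith [hs2.2]
  have htsup : tsupport (fun x => ∫ s in a..x, χ s) ⊆ Icc m M :=
    closure_minimal hsup isClosed_Icc
  refine ⟨fun x => ∫ s in a..x, χ s, ?_, HasCompactSupport.of_support_subset_isCompact
    isCompact_Icc hsup, htsup.trans fun x hx => ⟨by linarith [hx.1], by linarith [hx.2]⟩, hderiv⟩
  have := contDiff_infty_iff_deriv (𝕜 := ℝ) (f := fun x => ∫ s in a..x, χ s)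
  exact this.2 ⟨fun x => (hd x).differentiableAt, by rw [hderiv]; exact hχ⟩

/-- A function with vanishing weak derivative is constant. -/
theorem IsWeakDeriv.ae_const {a b : ℝ} (hab : a < b) {v : ℝ → ℝ}
    (hv : IntegrableOn v (Ioo a b)) (h : IsWeakDeriv 1 a b v 0) :
    ∃ C : ℝ, v =ᵐ[volume.restrict (Ioo a b)] fun _ => C := by
  obtain ⟨ψ, hψ, hψc, hψs, hψ1⟩ := exists_test_integral_eq_one hab
  refine ⟨∫ x in Ioo a b, v x * ψ x, ?_⟩
  set C := ∫ x in Ioo a b, v x * ψ x with hC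
  have h0 : (fun x => v x - C) =ᵐ[volume.restrict (Ioo a b)] 0 := by
    refine ae_eq_zero_of_forall_test (hv.sub (integrableOn_const (by simp))) fun φ hφ hc hs => ?_
    have hφi : IntegrableOn φ (Ioo a b) := (hφ.continuous.integrable_of_hasCompactSupport hc).integrableOn
    have hψi : IntegrableOn ψ (Ioo a b) := (hψ.continuous.integrable_of_hasCompactSupport hψc).integrableOn
    set m := ∫ x in Ioo a b, φ x with hm
    -- The du Bois-Reymond trick: subtracting `m ψ` makes the mean zero, so `φ - m ψ` is the
    -- derivative of a test function and `v` annihilates it.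
    obtain ⟨χ, hχ, hχc, hχs, hχd⟩ := exists_test_deriv_eq (a := a) (b := b)
      (χ := fun x => φ x - m * ψ x) (hφ.sub (contDiff_const.mul hψ)) (hc.sub hψc.mul_left)
      ((tsupport_sub φ (fun x => m * ψ x)).trans
        (union_subset hs ((tsupport_mul_subset_right).trans hψs))) (by
        rw [integral_sub hφi (hψi.const_mul m), integral_const_mul, hψ1]
        simp [hm])
    have e := h χ hχ hχc hχs
    rw [iteratedDeriv_one, hχd] at e
    have i1 := integrable_mul_test hv hφ.continuous hc
    have i2 := integrable_mul_test hv hψ.continuous hψc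
    have e2 : ∫ x in Ioo a b, v x * (φ x - m * ψ x)
        = (∫ x in Ioo a b, v x * φ x) - m * C := by
      rw [hC, ← integral_const_mul, ← integral_sub i1 (i2.const_mul m)]
      congr 1; ext x; ring
    rw [e2] at e
    simp only [Pi.zero_apply, zero_mul, integral_zero, mul_zero] at e
    have e3 : ∫ x in Ioo a b, (v x - C) * φ x = (∫ x in Ioo a b, v x * φ x) - C * m := by
      rw [hm, ← integral_const_mul, ← integral_sub i1 (hφi.const_mul C)]
      congr 1; ext x; ring
    rw [e3]
    linarith
  filter_upwards [h0] with x hx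
  exact sub_eq_zero.1 hx

/-- A function with an integrable weak derivative has an absolutely continuous representative. -/
theorem IsWeakDeriv.exists_const {a b : ℝ} (hab : a < b) {v w : ℝ → ℝ}
    (hv : IntegrableOn v (Ioo a b)) (hw : IntegrableOn w (Ioo a b)) (h : IsWeakDeriv 1 a b v w) :
    ∃ C : ℝ, v =ᵐ[volume.restrict (Ioo a b)] fun x => C + ∫ s in a..x, w s := by
  have hp : IsPrimitiveOn a b (fun x => ∫ s in a..x, w s) w :=
    ⟨intervalIntegrable_of_integrableOn_Ioo hab.le hw, fun x _ => by simp⟩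
  have hpi : IntegrableOn (fun x => ∫ s in a..x, w s) (Ioo a b) :=
    ((hp.continuousOn hab.le).integrableOn_compact isCompact_Icc).mono_set Ioo_subset_Icc_self
  obtain ⟨C, hC⟩ := IsWeakDeriv.ae_const hab (v := fun x => v x - ∫ s in a..x, w s)
    (hv.sub hpi) (by
      intro φ hφ hc hs
      have e1 := h φ hφ hc hs
      have e2 := hp.isWeakDeriv hab.le EventuallyEq.rfl φ hφ hc hs
      have hφ' : Continuous (iteratedDeriv 1 φ) := by
        rw [iteratedDeriv_one]; exact hφ.continuous_deriv (by simp)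
      have hc' : HasCompactSupport (iteratedDeriv 1 φ) := by
        rw [iteratedDeriv_one]; exact hc.deriv
      simp_rw [sub_mul]
      rw [integral_sub (integrable_mul_test hv hφ' hc') (integrable_mul_test hpi hφ' hc'), e1, e2]
      simp)
  refine ⟨C, ?_⟩
  filter_upwards [hC] with x hx
  linarith

/-- The second weak derivative is the weak derivative of the first one. -/
theorem IsWeakDeriv.two_of_one {a b : ℝ} {v w₁ w₂ : ℝ → ℝ} (h₁ : IsWeakDeriv 1 a b v w₁)
    (h₂ : IsWeakDeriv 2 a b v w₂) : IsWeakDeriv 1 a b w₁ w₂ := by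
  intro φ hφ hc hs
  have e1 := h₁ (deriv φ) ((contDiff_infty_iff_deriv.1 hφ).2) hc.deriv
    (Subset.trans (tsupport_deriv_subset (𝕜 := ℝ)) hs)
  have e2 := h₂ φ hφ hc hs
  rw [iteratedDeriv_one] at e1 ⊢
  rw [show iteratedDeriv 2 φ = deriv (deriv φ) by rw [iteratedDeriv_succ, iteratedDeriv_one]] at e2
  rw [e2] at e1
  simp only [pow_one, even_two, Even.neg_pow, one_pow, one_mul] at e1 ⊢
  linarith

theorem HasL2WeakDeriv.weakDeriv_spec {k : ℕ} {a b : ℝ} {v : ℝ → ℝ} (h : HasL2WeakDeriv k a b v) :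
    MemLp (weakDeriv k a b v) 2 (volume.restrict (Ioo a b)) ∧
      IsWeakDeriv k a b v (weakDeriv k a b v) := by
  rw [weakDeriv, dif_pos h]
  exact h.choose_spec

theorem integrableOn_of_memLp_two {a b : ℝ} {f : ℝ → ℝ}
    (hf : MemLp f 2 (volume.restrict (Ioo a b))) : IntegrableOn f (Ioo a b) :=
  hf.integrable (by norm_num)

/-- `weakDeriv` is a choice; uniqueness allows any explicit `L²` derivative to replace it inside
`stiffForm` and `semiH2`. -/
theorem IsWeakDeriv.weakDeriv_ae_eq {k : ℕ} {a b : ℝ} {v w : ℝ → ℝ} (h : IsWeakDeriv k a b v w)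
    (hw : MemLp w 2 (volume.restrict (Ioo a b))) :
    weakDeriv k a b v =ᵐ[volume.restrict (Ioo a b)] w :=
  have hs := HasL2WeakDeriv.weakDeriv_spec ⟨w, hw, h⟩
  hs.2.ae_eq h (integrableOn_of_memLp_two hs.1) (integrableOn_of_memLp_two hw)

/-! ### Traces -/

/-- A one-sided neighbourhood contains an interval of positive measure and so meets every conull
set. This makes essential one-sided limits unique. -/
theorem neBot_nhdsGT_inf_ae (a : ℝ) : (𝓝[>] a ⊓ ae (volume : Measure ℝ)).NeBot := by
  rw [inf_neBot_iff]
  intro s hs t ht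
  by_contra hcon
  rw [not_nonempty_iff_eq_empty] at hcon
  obtain ⟨b, hb, hbs⟩ := mem_nhdsGT_iff_exists_Ioo_subset.1 hs
  have h0 : volume (Ioo a b) ≤ 0 := by
    rw [← mem_ae_iff.1 ht]
    exact measure_mono fun x hx hxt => by
      have : x ∈ s ∩ t := ⟨hbs hx, hxt⟩
      simp [hcon] at this
  rw [mem_Ioi] at hb
  simp at h0
  linarith

theorem neBot_nhdsLT_inf_ae (a : ℝ) : (𝓝[<] a ⊓ ae (volume : Measure ℝ)).NeBot := by
  rw [inf_neBot_iff]
  intro s hs t ht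
  by_contra hcon
  rw [not_nonempty_iff_eq_empty] at hcon
  obtain ⟨b, hb, hbs⟩ := mem_nhdsLT_iff_exists_Ioo_subset.1 hs
  have h0 : volume (Ioo b a) ≤ 0 := by
    rw [← mem_ae_iff.1 ht]
    exact measure_mono fun x hx hxt => by
      have : x ∈ s ∩ t := ⟨hbs hx, hxt⟩
      simp [hcon] at this
  rw [mem_Iio] at hb
  simp at h0
  linarith

/-- Traces are computed as values of a continuous representative; with uniqueness, this identifies
the integration constants of the representatives below. -/
theorem hasTraceRight_of_ae_eq {a b : ℝ} (hab : a < b) {v V : ℝ → ℝ}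
    (hV : ContinuousOn V (Icc a b)) (h : v =ᵐ[volume.restrict (Ioo a b)] V) :
    HasTraceRight v a (V a) := by
  have h1 : Tendsto V (𝓝[>] a) (𝓝 (V a)) :=
    ((hV a ⟨le_rfl, hab.le⟩).mono_of_mem_nhdsWithin (Icc_mem_nhdsGT hab)).tendsto
  refine (h1.mono_left inf_le_left).congr' ?_
  have h2 := (ae_restrict_iff' measurableSet_Ioo).1 h
  filter_upwards [mem_inf_of_left (Ioo_mem_nhdsGT hab), mem_inf_of_right h2] with x hx hx2
  exact (hx2 hx).symm

theorem hasTraceLeft_of_ae_eq {a b : ℝ} (hab : a < b) {v V : ℝ → ℝ}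
    (hV : ContinuousOn V (Icc a b)) (h : v =ᵐ[volume.restrict (Ioo a b)] V) :
    HasTraceLeft v b (V b) := by
  have h1 : Tendsto V (𝓝[<] b) (𝓝 (V b)) :=
    ((hV b ⟨hab.le, le_rfl⟩).mono_of_mem_nhdsWithin (Icc_mem_nhdsLT hab)).tendsto
  refine (h1.mono_left inf_le_left).congr' ?_
  have h2 := (ae_restrict_iff' measurableSet_Ioo).1 h
  filter_upwards [mem_inf_of_left (Ioo_mem_nhdsLT hab), mem_inf_of_right h2] with x hx hx2
  exact (hx2 hx).symm

theorem HasTraceRight.unique {v : ℝ → ℝ} {a l l' : ℝ} (h : HasTraceRight v a l)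
    (h' : HasTraceRight v a l') : l = l' :=
  haveI := neBot_nhdsGT_inf_ae a
  tendsto_nhds_unique h h'

theorem HasTraceLeft.unique {v : ℝ → ℝ} {a l l' : ℝ} (h : HasTraceLeft v a l)
    (h' : HasTraceLeft v a l') : l = l' :=
  haveI := neBot_nhdsLT_inf_ae a
  tendsto_nhds_unique h h'

/-- Two successive weak derivatives give a weak derivative of order two. -/
theorem IsWeakDeriv.comp {a b : ℝ} {v w₁ w₂ : ℝ → ℝ} (h₁ : IsWeakDeriv 1 a b v w₁)
    (h₂ : IsWeakDeriv 1 a b w₁ w₂) : IsWeakDeriv 2 a b v w₂ := by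
  intro φ hφ hc hs
  have e1 := h₁ (deriv φ) ((contDiff_infty_iff_deriv.1 hφ).2) hc.deriv
    (Subset.trans (tsupport_deriv_subset (𝕜 := ℝ)) hs)
  have e2 := h₂ φ hφ hc hs
  rw [iteratedDeriv_one] at e1 e2
  rw [show iteratedDeriv 2 φ = deriv (deriv φ) by rw [iteratedDeriv_succ, iteratedDeriv_one],
    e1, e2]
  ring

theorem IsWeakDeriv.congr {k : ℕ} {a b : ℝ} {v v' w w' : ℝ → ℝ} (h : IsWeakDeriv k a b v w)
    (hv : v =ᵐ[volume.restrict (Ioo a b)] v') (hw : w =ᵐ[volume.restrict (Ioo a b)] w') :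
    IsWeakDeriv k a b v' w' := by
  intro φ hφ hc hs
  have e := h φ hφ hc hs
  have e1 : ∫ x in Ioo a b, v' x * iteratedDeriv k φ x = ∫ x in Ioo a b, v x * iteratedDeriv k φ x :=
    integral_congr_ae (by filter_upwards [hv] with x hx; rw [hx])
  have e2 : ∫ x in Ioo a b, w' x * φ x = ∫ x in Ioo a b, w x * φ x :=
    integral_congr_ae (by filter_upwards [hw] with x hx; rw [hx])
  rw [e1, e2, e]

namespace Data

variable (P : Data)

/-! ### The domain and the coefficient -/

/-- The piecewise constant coefficient `κ`. -/
def kap (x : ℝ) : ℝ := if 0 < x then P.kp else P.km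

theorem kp_pos : 0 < P.kp := half_pos P.lam_pos

theorem km_pos : 0 < P.km := half_pos (sub_pos.2 P.lam_lt_one)

theorem kap_pos (x : ℝ) : 0 < P.kap x := by
  unfold kap; split_ifs
  exacts [P.kp_pos, P.km_pos]

theorem one_le_rho : 1 ≤ P.rho := by
  rcases le_total P.km P.kp with h | h
  · exact ((one_le_div P.km_pos).2 h).trans (le_max_right _ _)
  · exact ((one_le_div P.kp_pos).2 h).trans (le_max_left _ _)

theorem rho_nonneg : 0 ≤ P.rho := zero_le_one.trans P.one_le_rho

/-- Values of `κ` at two arbitrary points are compared; this is how `ρ` enters the interpolation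
constant. -/
theorem kap_le (x y : ℝ) : P.kap x ≤ P.rho * P.kap y := by
  have h1 : P.km ≤ P.rho * P.kp := (div_le_iff₀ P.kp_pos).1 (le_max_left _ _)
  have h2 : P.kp ≤ P.rho * P.km := (div_le_iff₀ P.km_pos).1 (le_max_right _ _)
  have h3 := P.one_le_rho
  have h4 := P.kp_pos
  have h5 := P.km_pos
  unfold kap
  split_ifs <;> nlinarith

theorem measurable_kap : Measurable P.kap :=
  Measurable.ite measurableSet_Ioi measurable_const measurable_const

theorem kap_le_add (x : ℝ) : P.kap x ≤ P.kp + P.km := by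
  unfold kap; split_ifs <;> linarith [P.kp_pos, P.km_pos]

theorem min_le_kap (x : ℝ) : min P.kp P.km ≤ P.kap x := by
  unfold kap; split_ifs
  exacts [min_le_left _ _, min_le_right _ _]

theorem norm_kap_le (x : ℝ) : ‖P.kap x‖ ≤ P.kp + P.km := by
  rw [Real.norm_of_nonneg (P.kap_pos x).le]
  exact P.kap_le_add x

theorem norm_inv_kap_le (x : ℝ) : ‖(P.kap x)⁻¹‖ ≤ (min P.kp P.km)⁻¹ := by
  rw [Real.norm_of_nonneg (inv_nonneg.2 (P.kap_pos x).le)]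
  exact inv_anti₀ (lt_min P.kp_pos P.km_pos) (P.min_le_kap x)

theorem neg_L_lt : -P.L < P.L := by linarith [P.L_pos]

theorem neg_L_lt_zero : -P.L < 0 := by linarith [P.L_pos]

theorem zero_mem_Icc : (0 : ℝ) ∈ Icc (-P.L) P.L := ⟨P.neg_L_lt_zero.le, P.L_pos.le⟩

/-- The interface is a null set, so integrals over the domain split into the two halves used by the
broken definitions. -/
theorem vol_eq_add :
    P.vol = volume.restrict (Ioo (-P.L) 0) + volume.restrict (Ioo 0 P.L) := by
  have h : (Ioo (-P.L) 0 ∪ Ioo 0 P.L : Set ℝ) =ᵐ[volume] Ioo (-P.L) P.L := by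
    have h0 : ∀ᵐ x : ℝ, x ≠ 0 := by simp [ae_iff, measure_singleton]
    filter_upwards [h0] with x hx
    refine propext ⟨?_, ?_⟩
    · rintro (h | h)
      exacts [⟨h.1, h.2.trans P.L_pos⟩, ⟨P.neg_L_lt_zero.trans h.1, h.2⟩]
    · intro h
      rcases lt_or_gt_of_ne hx with h' | h'
      exacts [Or.inl ⟨h.1, h'⟩, Or.inr ⟨h', h.2⟩]
  rw [vol, ← Measure.restrict_congr_set h, Measure.restrict_union _ measurableSet_Ioo]
  exact disjoint_left.2 fun x hx hx' => lt_asymm hx.2 hx'.1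

variable {P} in
theorem ae_eq_vol {f g : ℝ → ℝ} (hl : f =ᵐ[volume.restrict (Ioo (-P.L) 0)] g)
    (hr : f =ᵐ[volume.restrict (Ioo 0 P.L)] g) : f =ᵐ[P.vol] g := by
  rw [vol_eq_add, EventuallyEq, ae_add_measure_iff]
  exact ⟨hl, hr⟩

instance : IsFiniteMeasure P.vol := by unfold vol; infer_instance

theorem vol_left_le : volume.restrict (Ioo (-P.L) 0) ≤ P.vol :=
  Measure.restrict_mono (Ioo_subset_Ioo_right P.L_pos.le) le_rfl

theorem vol_right_le : volume.restrict (Ioo 0 P.L) ≤ P.vol :=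
  Measure.restrict_mono (Ioo_subset_Ioo_left P.neg_L_lt_zero.le) le_rfl

theorem integral_vol (f : ℝ → ℝ) : ∫ x, f x ∂P.vol = ∫ x in (-P.L)..P.L, f x :=
  setIntegral_Ioo_eq_intervalIntegral P.neg_L_lt.le f

theorem intervalIntegrable_of_vol {f : ℝ → ℝ} (hf : Integrable f P.vol) :
    IntervalIntegrable f volume (-P.L) P.L :=
  intervalIntegrable_of_integrableOn_Ioo P.neg_L_lt.le hf

theorem memLp_of_continuousOn {f : ℝ → ℝ} (hf : ContinuousOn f (Icc (-P.L) P.L)) :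
    MemLp f 2 P.vol := by
  obtain ⟨C, hC⟩ := isCompact_Icc.exists_bound_of_continuousOn hf
  refine MemLp.of_bound ((hf.mono Ioo_subset_Icc_self).aestronglyMeasurable measurableSet_Ioo) C ?_
  exact (ae_restrict_iff' measurableSet_Ioo).2
    (ae_of_all _ fun x hx => hC x (Ioo_subset_Icc_self hx))

variable {P}

theorem memLp_kap_mul {f : ℝ → ℝ} (hf : MemLp f 2 P.vol) :
    MemLp (fun x => P.kap x * f x) 2 P.vol := by
  refine hf.of_le_mul (c := P.kp + P.km) (P.measurable_kap.aestronglyMeasurable.mul hf.1)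
    (ae_of_all _ fun x => ?_)
  rw [norm_mul]
  exact mul_le_mul_of_nonneg_right (P.norm_kap_le x) (norm_nonneg _)

theorem memLp_div_kap {f : ℝ → ℝ} (hf : MemLp f 2 P.vol) :
    MemLp (fun x => f x / P.kap x) 2 P.vol := by
  simp_rw [div_eq_inv_mul]
  refine hf.of_le_mul (c := (min P.kp P.km)⁻¹)
    (P.measurable_kap.inv.aestronglyMeasurable.mul hf.1) (ae_of_all _ fun x => ?_)
  rw [norm_mul]
  exact mul_le_mul_of_nonneg_right (P.norm_inv_kap_le x) (norm_nonneg _)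

/-! ### Representatives of functions of `H^1_0` -/

/-- `V` vanishes at the ends of the domain and has the square integrable derivative `d`. -/
structure HasGrad (P : Data) (V d : ℝ → ℝ) : Prop where
  memLp : MemLp d 2 P.vol
  prim : IsPrimitiveOn (-P.L) P.L V d
  left : V (-P.L) = 0
  right : V P.L = 0

namespace HasGrad

variable {V d W e v w : ℝ → ℝ}

theorem continuousOn (h : P.HasGrad V d) : ContinuousOn V (Icc (-P.L) P.L) :=
  h.prim.continuousOn P.neg_L_lt.le

theorem memLp_self (h : P.HasGrad V d) : MemLp V 2 P.vol :=
  P.memLp_of_continuousOn h.continuousOn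

theorem add (h : P.HasGrad V d) (h' : P.HasGrad W e) :
    P.HasGrad (fun x => V x + W x) (fun x => d x + e x) :=
  ⟨h.memLp.add h'.memLp, h.prim.add h'.prim, by simp [h.left, h'.left], by simp [h.right, h'.right]⟩

theorem sub (h : P.HasGrad V d) (h' : P.HasGrad W e) :
    P.HasGrad (fun x => V x - W x) (fun x => d x - e x) :=
  ⟨h.memLp.sub h'.memLp, h.prim.sub h'.prim, by simp [h.left, h'.left], by simp [h.right, h'.right]⟩

theorem const_mul (r : ℝ) (h : P.HasGrad V d) :
    P.HasGrad (fun x => r * V x) (fun x => r * d x) :=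
  ⟨h.memLp.const_mul r, h.prim.const_mul r, by simp [h.left], by simp [h.right]⟩

theorem isWeakDeriv_left (h : P.HasGrad V d) (hv : v =ᵐ[P.vol] V) :
    IsWeakDeriv 1 (-P.L) 0 v d :=
  (h.prim.mono (left_mem_Icc.2 P.neg_L_lt.le) P.zero_mem_Icc).isWeakDeriv P.neg_L_lt_zero.le
    (hv.filter_mono (ae_mono P.vol_left_le))

theorem isWeakDeriv_right (h : P.HasGrad V d) (hv : v =ᵐ[P.vol] V) :
    IsWeakDeriv 1 0 P.L v d :=
  (h.prim.mono P.zero_mem_Icc (right_mem_Icc.2 P.neg_L_lt.le)).isWeakDeriv P.L_pos.le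
    (hv.filter_mono (ae_mono P.vol_right_le))

theorem memLp_left (h : P.HasGrad V d) : MemLp d 2 (volume.restrict (Ioo (-P.L) 0)) :=
  h.memLp.mono_measure P.vol_left_le

theorem memLp_right (h : P.HasGrad V d) : MemLp d 2 (volume.restrict (Ioo 0 P.L)) :=
  h.memLp.mono_measure P.vol_right_le

theorem integrable_mul (h : P.HasGrad V d) (h' : P.HasGrad W e) :
    Integrable (fun x => P.kap x * d x * e x) P.vol :=
  (memLp_kap_mul h.memLp).integrable_mul h'.memLp

/-- The two halves have a common derivative representative `d`, so the broken form becomes one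
integral, free of choices, on which linearity and positivity are immediate. -/
theorem stiffForm_eq (h : P.HasGrad V d) (h' : P.HasGrad W e) (hv : v =ᵐ[P.vol] V)
    (hw : w =ᵐ[P.vol] W) :
    P.stiffForm v w = ∫ x, P.kap x * d x * e x ∂P.vol := by
  have hi := h.integrable_mul h'
  rw [vol_eq_add] at hi ⊢
  rw [integral_add_measure hi.left_of_add_measure hi.right_of_add_measure, stiffForm]
  congr 1
  · apply integral_congr_ae
    filter_upwards [(h.isWeakDeriv_left hv).weakDeriv_ae_eq h.memLp_left,
      (h'.isWeakDeriv_left hw).weakDeriv_ae_eq h'.memLp_left,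
      ae_restrict_mem measurableSet_Ioo] with x h1 h2 h3
    rw [h1, h2, kap, if_neg (not_lt.2 h3.2.le)]
  · apply integral_congr_ae
    filter_upwards [(h.isWeakDeriv_right hv).weakDeriv_ae_eq h.memLp_right,
      (h'.isWeakDeriv_right hw).weakDeriv_ae_eq h'.memLp_right,
      ae_restrict_mem measurableSet_Ioo] with x h1 h2 h3
    rw [h1, h2, kap, if_pos h3.1]

/-- Finite element functions become admissible test functions in the weak equation through this. -/
theorem memBrokenZero (h : P.HasGrad V d) : P.MemBrokenZero 1 V where
  memBroken :=
    { memLp := h.memLp_self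
      left := ⟨h.memLp_self.mono_measure P.vol_left_le, fun j h1 h2 => by
        obtain rfl : j = 1 := le_antisymm h2 h1
        exact ⟨d, h.memLp_left, h.isWeakDeriv_left EventuallyEq.rfl⟩⟩
      right := ⟨h.memLp_self.mono_measure P.vol_right_le, fun j h1 h2 => by
        obtain rfl : j = 1 := le_antisymm h2 h1
        exact ⟨d, h.memLp_right, h.isWeakDeriv_right EventuallyEq.rfl⟩⟩
      jump := fun _ => ⟨V 0,
        hasTraceLeft_of_ae_eq P.neg_L_lt_zero
          (h.continuousOn.mono (Icc_subset_Icc_right P.L_pos.le)) EventuallyEq.rfl,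
        hasTraceRight_of_ae_eq P.L_pos
          (h.continuousOn.mono (Icc_subset_Icc_left P.neg_L_lt_zero.le)) EventuallyEq.rfl⟩
      flux := fun h2 => absurd h2 (by norm_num) }
  bdry_left := by
    have := hasTraceRight_of_ae_eq P.neg_L_lt h.continuousOn (EventuallyEq.rfl)
    rwa [h.left] at this
  bdry_right := by
    have := hasTraceLeft_of_ae_eq P.neg_L_lt h.continuousOn (EventuallyEq.rfl)
    rwa [h.right] at this

end HasGrad

/-! ### Representatives of functions of `H^{2,0} ∩ H^1_0` -/

/-- `V` vanishes at the ends of the domain, has the absolutely continuous flux `q = κ V'` and the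
square integrable broken second derivative `G`. -/
structure HasFlux (P : Data) (V q G : ℝ → ℝ) : Prop where
  memLp : MemLp G 2 P.vol
  prim : IsPrimitiveOn (-P.L) P.L V fun x => q x / P.kap x
  flux : IsPrimitiveOn (-P.L) P.L q fun x => P.kap x * G x
  left : V (-P.L) = 0
  right : V P.L = 0

namespace HasFlux

variable {V q G V' q' G' v : ℝ → ℝ}

theorem hasGrad (h : P.HasFlux V q G) : P.HasGrad V fun x => q x / P.kap x :=
  ⟨memLp_div_kap (P.memLp_of_continuousOn (h.flux.continuousOn P.neg_L_lt.le)), h.prim, h.left,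
    h.right⟩

theorem sub (h : P.HasFlux V q G) (h' : P.HasFlux V' q' G') :
    P.HasFlux (fun x => V x - V' x) (fun x => q x - q' x) (fun x => G x - G' x) :=
  ⟨h.memLp.sub h'.memLp, by simpa only [sub_div] using h.prim.sub h'.prim,
    by simpa only [mul_sub] using h.flux.sub h'.flux, by simp [h.left, h'.left],
    by simp [h.right, h'.right]⟩

theorem isWeakDeriv_two_left (h : P.HasFlux V q G) (hv : v =ᵐ[P.vol] V) :
    IsWeakDeriv 2 (-P.L) 0 v G := by
  refine (h.hasGrad.isWeakDeriv_left hv).comp ?_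
  have h1 := ((h.flux.mono (left_mem_Icc.2 P.neg_L_lt.le) P.zero_mem_Icc).const_mul
    P.km⁻¹).isWeakDeriv P.neg_L_lt_zero.le (v := fun x => q x / P.kap x) (by
      filter_upwards [ae_restrict_mem measurableSet_Ioo] with x hx
      rw [kap, if_neg (not_lt.2 hx.2.le), div_eq_inv_mul])
  refine h1.congr EventuallyEq.rfl ?_
  filter_upwards [ae_restrict_mem measurableSet_Ioo] with x hx
  rw [kap, if_neg (not_lt.2 hx.2.le), inv_mul_cancel_left₀ P.km_pos.ne']

theorem isWeakDeriv_two_right (h : P.HasFlux V q G) (hv : v =ᵐ[P.vol] V) :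
    IsWeakDeriv 2 0 P.L v G := by
  refine (h.hasGrad.isWeakDeriv_right hv).comp ?_
  have h1 := ((h.flux.mono P.zero_mem_Icc (right_mem_Icc.2 P.neg_L_lt.le)).const_mul
    P.kp⁻¹).isWeakDeriv P.L_pos.le (v := fun x => q x / P.kap x) (by
      filter_upwards [ae_restrict_mem measurableSet_Ioo] with x hx
      rw [kap, if_pos hx.1, div_eq_inv_mul])
  refine h1.congr EventuallyEq.rfl ?_
  filter_upwards [ae_restrict_mem measurableSet_Ioo] with x hx
  rw [kap, if_pos hx.1, inv_mul_cancel_left₀ P.kp_pos.ne']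

theorem semiH2_eq (h : P.HasFlux V q G) (hv : v =ᵐ[P.vol] V) :
    P.semiH2 v = Real.sqrt (∫ x, G x ^ 2 ∂P.vol) := by
  have hi : Integrable (fun x => G x ^ 2) P.vol := h.memLp.integrable_sq
  rw [semiH2]
  rw [vol_eq_add] at hi ⊢
  rw [integral_add_measure hi.left_of_add_measure hi.right_of_add_measure]
  congr 2
  · apply integral_congr_ae
    filter_upwards [(h.isWeakDeriv_two_left hv).weakDeriv_ae_eq
      (h.memLp.mono_measure P.vol_left_le)] with x hx
    rw [hx]
  · apply integral_congr_ae
    filter_upwards [(h.isWeakDeriv_two_right hv).weakDeriv_ae_eq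
      (h.memLp.mono_measure P.vol_right_le)] with x hx
    rw [hx]

end HasFlux

theorem memLp_ite {f g : ℝ → ℝ} (hf : MemLp f 2 (volume.restrict (Ioo (-P.L) 0)))
    (hg : MemLp g 2 (volume.restrict (Ioo 0 P.L))) :
    MemLp (fun x => if 0 < x then g x else f x) 2 P.vol := by
  have hf' : f =ᵐ[volume.restrict (Ioo (-P.L) 0)] fun x => if 0 < x then g x else f x := by
    filter_upwards [ae_restrict_mem measurableSet_Ioo] with x hx
    rw [if_neg (not_lt.2 hx.2.le)]
  have hg' : g =ᵐ[volume.restrict (Ioo 0 P.L)] fun x => if 0 < x then g x else f x := by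
    filter_upwards [ae_restrict_mem measurableSet_Ioo] with x hx
    rw [if_pos hx.1]
  have hf2 := hf.ae_eq hf'
  have hg2 := hg.ae_eq hg'
  rw [vol_eq_add]
  refine (memLp_two_iff_integrable_sq (hf2.1.add_measure hg2.1)).2 ?_
  exact hf2.integrable_sq.add_measure hg2.integrable_sq

/-- A function of `H^{2,0} ∩ H^1_0` has a representative with an absolutely continuous flux. -/
theorem MemBrokenZero.exists_hasFlux {v : ℝ → ℝ} (hv : P.MemBrokenZero 2 v) :
    ∃ V q G : ℝ → ℝ, v =ᵐ[P.vol] V ∧ P.HasFlux V q G := by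
  obtain ⟨hLp, hl, hr, hjump, hflux⟩ := hv.memBroken
  obtain ⟨l, hjl, hjr⟩ := hjump (by norm_num)
  obtain ⟨Q, hQl, hQr⟩ := hflux le_rfl
  obtain ⟨m1, d1⟩ := (hl.2 1 le_rfl (by norm_num)).weakDeriv_spec
  obtain ⟨m2, d2⟩ := (hl.2 2 (by norm_num) le_rfl).weakDeriv_spec
  obtain ⟨n1, e1⟩ := (hr.2 1 le_rfl (by norm_num)).weakDeriv_spec
  obtain ⟨n2, e2⟩ := (hr.2 2 (by norm_num) le_rfl).weakDeriv_spec
  set w1 := weakDeriv 1 (-P.L) 0 v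
  set w2 := weakDeriv 2 (-P.L) 0 v
  set z1 := weakDeriv 1 0 P.L v
  set z2 := weakDeriv 2 0 P.L v
  have hL := P.L_pos
  have hL' := P.neg_L_lt_zero
  set G : ℝ → ℝ := fun x => if 0 < x then z2 x else w2 x with hG
  have hGm : MemLp G 2 P.vol := memLp_ite m2 n2
  have hKG : IntervalIntegrable (fun x => P.kap x * G x) volume (-P.L) P.L :=
    P.intervalIntegrable_of_vol ((memLp_kap_mul hGm).integrable (by norm_num))
  have hneg : -P.L ∈ Icc (-P.L) P.L := left_mem_Icc.2 P.neg_L_lt.le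
  have hKG' : ∀ x ∈ Icc (-P.L) P.L, ∀ y ∈ Icc (-P.L) P.L,
      IntervalIntegrable (fun x => P.kap x * G x) volume x y := fun x hx y hy =>
    hKG.mono_set (by rw [uIcc_of_le P.neg_L_lt.le]; exact uIcc_subset_Icc hx hy)
  -- The flux is rebuilt from the common trace `Q` at the interface, which makes it a single
  -- absolutely continuous function across `0`. Integrating `q / κ` from `-L` then builds in the
  -- left boundary value.
  set q : ℝ → ℝ := fun x => Q + ∫ s in (0 : ℝ)..x, P.kap s * G s with hq
  have hqp : IsPrimitiveOn (-P.L) P.L q fun x => P.kap x * G x := ⟨hKG, fun x hx => by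
    rw [hq]
    simp only
    rw [add_assoc, intervalIntegral.integral_add_adjacent_intervals
      (hKG' 0 P.zero_mem_Icc _ hneg) (hKG' _ hneg x hx)]⟩
  have hqc : ContinuousOn q (Icc (-P.L) P.L) := hqp.continuousOn P.neg_L_lt.le
  have hq0 : q 0 = Q := by simp [hq]
  set V : ℝ → ℝ := fun x => ∫ s in (-P.L)..x, q s / P.kap s with hV
  have hdm : MemLp (fun x => q x / P.kap x) 2 P.vol :=
    memLp_div_kap (P.memLp_of_continuousOn hqc)
  have hVp : IsPrimitiveOn (-P.L) P.L V fun x => q x / P.kap x :=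
    ⟨P.intervalIntegrable_of_vol (hdm.integrable (by norm_num)), fun x _ => by simp [hV]⟩
  have hVc := hVp.continuousOn P.neg_L_lt.le
  have hVL : V (-P.L) = 0 := by simp [hV]
  -- the flux on the left
  have hw1 : w1 =ᵐ[volume.restrict (Ioo (-P.L) 0)] fun x => q x / P.kap x := by
    obtain ⟨C, hC⟩ := (d1.two_of_one d2).exists_const hL' (integrableOn_of_memLp_two m1)
      (integrableOn_of_memLp_two m2)
    have hp : IsPrimitiveOn (-P.L) 0 (fun x => P.km * (C + ∫ s in (-P.L)..x, w2 s))
        (fun x => P.km * w2 x) := by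
      refine IsPrimitiveOn.const_mul _ ⟨intervalIntegrable_of_integrableOn_Ioo hL'.le
        (integrableOn_of_memLp_two m2), fun x _ => by simp⟩
    have htr := hasTraceLeft_of_ae_eq (v := fun x => P.km * w1 x) hL' (hp.continuousOn hL'.le) (by
      filter_upwards [hC] with x hx
      rw [hx])
    have hQ := htr.unique hQl
    filter_upwards [hC, ae_restrict_mem measurableSet_Ioo] with x hx hxm
    have hx0 : x ∈ Icc (-P.L) 0 := ⟨hxm.1.le, hxm.2.le⟩
    have h1 := hp.sub_eq hx0 (right_mem_Icc.2 hL'.le)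
    have h2 := hqp.sub_eq (x := x) ⟨hx0.1, hx0.2.trans hL.le⟩ P.zero_mem_Icc
    have h3 : ∫ s in x..0, P.kap s * G s = ∫ s in x..0, P.km * w2 s := by
      apply intervalIntegral.integral_congr_ae
      refine ae_of_all _ fun s hs => ?_
      rw [uIoc_of_le hx0.2] at hs
      simp only [hG, kap, if_neg (not_lt.2 hs.2)]
    rw [h3, ← h1, hq0, hQ] at h2
    rw [hx, kap, if_neg (not_lt.2 hx0.2), eq_div_iff P.km_pos.ne']
    linarith
  have hz1 : z1 =ᵐ[volume.restrict (Ioo 0 P.L)] fun x => q x / P.kap x := by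
    obtain ⟨C, hC⟩ := (e1.two_of_one e2).exists_const hL (integrableOn_of_memLp_two n1)
      (integrableOn_of_memLp_two n2)
    have hp : IsPrimitiveOn 0 P.L (fun x => P.kp * (C + ∫ s in (0 : ℝ)..x, z2 s))
        (fun x => P.kp * z2 x) := by
      refine IsPrimitiveOn.const_mul _ ⟨intervalIntegrable_of_integrableOn_Ioo hL.le
        (integrableOn_of_memLp_two n2), fun x _ => by simp⟩
    have htr := hasTraceRight_of_ae_eq (v := fun x => P.kp * z1 x) hL (hp.continuousOn hL.le) (by
      filter_upwards [hC] with x hx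
      rw [hx])
    have hQ := htr.unique hQr
    filter_upwards [hC, ae_restrict_mem measurableSet_Ioo] with x hx hxm
    have hx0 : x ∈ Icc 0 P.L := ⟨hxm.1.le, hxm.2.le⟩
    have h1 := hp.sub_eq (left_mem_Icc.2 hL.le) hx0
    have h2 := hqp.sub_eq (y := x) P.zero_mem_Icc ⟨hL'.le.trans hx0.1, hx0.2⟩
    have h3 : ∫ s in (0 : ℝ)..x, P.kap s * G s = ∫ s in (0 : ℝ)..x, P.kp * z2 s := by
      apply intervalIntegral.integral_congr_ae
      refine ae_of_all _ fun s hs => ?_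
      rw [uIoc_of_le hx0.1] at hs
      simp only [hG, kap, if_pos hs.1]
    rw [h3, ← h1, hq0, hQ] at h2
    rw [hx, kap, if_pos hxm.1, eq_div_iff P.kp_pos.ne']
    linarith
  -- the function itself
  have hvl : v =ᵐ[volume.restrict (Ioo (-P.L) 0)] V := by
    have hvi := integrableOn_of_memLp_two (hLp.mono_measure P.vol_left_le)
    obtain ⟨C, hC⟩ := d1.exists_const hL' hvi (integrableOn_of_memLp_two m1)
    have hC' : v =ᵐ[volume.restrict (Ioo (-P.L) 0)] fun x => C + V x := by
      have h3 := (ae_restrict_iff' measurableSet_Ioo).1 hw1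
      filter_upwards [hC, ae_restrict_mem measurableSet_Ioo] with x hx hxm
      rw [hx]
      congr 1
      apply intervalIntegral.integral_congr_ae
      filter_upwards [h3] with s hs hs2
      rw [uIoc_of_le hxm.1.le] at hs2
      exact hs ⟨hs2.1, hs2.2.trans_lt hxm.2⟩
    -- The boundary condition at `-L` forces the constant on the left half to be zero.
    have htr := hasTraceRight_of_ae_eq hL'
      ((hVc.mono (Icc_subset_Icc_right hL.le)).const_add C) hC'
    have h0 := htr.unique hv.bdry_left
    rw [hVL, add_zero] at h0
    simpa [h0] using hC'
  have hvr : v =ᵐ[volume.restrict (Ioo 0 P.L)] V := by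
    have hvi := integrableOn_of_memLp_two (hLp.mono_measure P.vol_right_le)
    obtain ⟨C, hC⟩ := e1.exists_const hL hvi (integrableOn_of_memLp_two n1)
    have hC' : v =ᵐ[volume.restrict (Ioo 0 P.L)] fun x => (C - V 0) + V x := by
      have h3 := (ae_restrict_iff' measurableSet_Ioo).1 hz1
      filter_upwards [hC, ae_restrict_mem measurableSet_Ioo] with x hx hxm
      have h4 := hVp.sub_eq (y := x) P.zero_mem_Icc ⟨(hL'.trans hxm.1).le, hxm.2.le⟩
      have h5 : ∫ s in (0 : ℝ)..x, z1 s = ∫ s in (0 : ℝ)..x, q s / P.kap s := by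
        apply intervalIntegral.integral_congr_ae
        filter_upwards [h3] with s hs hs2
        rw [uIoc_of_le hxm.1.le] at hs2
        exact hs ⟨hs2.1, hs2.2.trans_lt hxm.2⟩
      rw [hx, h5, ← h4]
      ring
    have htr := hasTraceRight_of_ae_eq hL
      ((hVc.mono (Icc_subset_Icc_left hL'.le)).const_add (C - V 0)) hC'
    -- On the left half `v` is already `V`, so the condition `[v] = 0` forces the constant on the
    -- right half to vanish.
    have htl := hasTraceLeft_of_ae_eq hL' (hVc.mono (Icc_subset_Icc_right hL.le)) hvl
    have h0 := htr.unique hjr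
    have h1 := htl.unique hjl
    have h2 : C - V 0 = 0 := by linarith
    simpa [h2] using hC'
  have hvV : v =ᵐ[P.vol] V := ae_eq_vol hvl hvr
  refine ⟨V, q, G, hvV, hGm, hVp, hqp, hVL, ?_⟩
  exact (hasTraceLeft_of_ae_eq P.neg_L_lt hVc hvV).unique hv.bdry_right

end Data

/-! ### Gluing of primitives, and Cauchy–Schwarz on an interval. -/

namespace IsPrimitiveOn

variable {a b c : ℝ} {F f F' f' : ℝ → ℝ}

theorem glue (h₁ : IsPrimitiveOn a b F f) (h₂ : IsPrimitiveOn b c F f) (hab : a ≤ b) :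
    IsPrimitiveOn a c F f where
  integrable := h₁.integrable.trans h₂.integrable
  eq x hx := by
    rcases le_total x b with h | h
    · exact h₁.eq x ⟨hx.1, h⟩
    · have hb : b ∈ Icc b c := ⟨le_rfl, h.trans hx.2⟩
      rw [h₂.eq x ⟨h, hx.2⟩, h₁.eq b ⟨hab, le_rfl⟩,
        ← intervalIntegral.integral_add_adjacent_intervals h₁.integrable
          (h₂.integrable_sub hb ⟨h, hx.2⟩)]
      ring

/-- The derivatives are compared on the half-open interval only, which is the shape of the pieces of
`dphi`. -/
theorem congr (h : IsPrimitiveOn a b F f) (hab : a ≤ b) (hF : EqOn F' F (Icc a b))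
    (hf : EqOn f' f (Ioc a b)) :
    IsPrimitiveOn a b F' f' := by
  refine ⟨h.integrable.congr (by
    rw [uIoc_of_le hab]
    exact fun x hx => (hf hx).symm), fun x hx => ?_⟩
  rw [hF hx, hF (left_mem_Icc.2 hab), h.eq x hx]
  congr 1
  apply intervalIntegral.integral_congr_ae
  refine ae_of_all _ fun s hs => ?_
  rw [uIoc_of_le hx.1] at hs
  exact (hf ⟨hs.1, hs.2.trans hx.2⟩).symm

end IsPrimitiveOn

/-- A Cauchy-Schwarz inequality on an interval. -/
theorem sq_integral_abs_le {a b : ℝ} (hab : a < b) {G : ℝ → ℝ} (h1 : IntervalIntegrable G volume a b)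
    (h2 : IntervalIntegrable (fun x => G x ^ 2) volume a b) :
    (∫ x in a..b, |G x|) ^ 2 ≤ (b - a) * ∫ x in a..b, G x ^ 2 := by
  set J := ∫ x in a..b, |G x| with hJ
  have hba : 0 < b - a := sub_pos.2 hab
  -- `m` is the mean of `|G|`; integrating `(|G| - m)² ≥ 0` gives the inequality.
  set m := J / (b - a) with hm
  have h3 : 0 ≤ ∫ x in a..b, (G x ^ 2 - 2 * m * |G x| + m ^ 2) :=
    intervalIntegral.integral_nonneg hab.le fun x _ => by
      rw [← sq_abs (G x)]
      nlinarith [sq_nonneg (|G x| - m)]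
  have h4 := h1.abs.const_mul (2 * m)
  rw [intervalIntegral.integral_add (h2.sub h4) (by simp), intervalIntegral.integral_sub h2 h4,
    intervalIntegral.integral_const_mul, ← hJ, intervalIntegral.integral_const, smul_eq_mul] at h3
  have h5 : m * (b - a) = J := div_mul_cancel₀ J hba.ne'
  have h6 : 0 ≤ (∫ x in a..b, G x ^ 2) - m * J := by
    have : (b - a) * m ^ 2 = m * J := by rw [← h5]; ring
    rw [this] at h3
    linarith
  nlinarith [mul_nonneg hba.le h6]

namespace Data

variable {P : Data}

/-! ### Estimates on an element -/

theorem intervalIntegrable_kap_mul {a b : ℝ} {G : ℝ → ℝ} (hG : IntervalIntegrable G volume a b) :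
    IntervalIntegrable (fun x => P.kap x * G x) volume a b := by
  rw [intervalIntegrable_iff] at hG ⊢
  exact hG.bdd_mul P.measurable_kap.aestronglyMeasurable (ae_of_all _ P.norm_kap_le)

/-- If `(q - c) / κ` has mean zero then `q - c` is bounded by the variation of `q`. -/
theorem abs_flux_sub_le {a b c : ℝ} (hab : a < b) {E d q G : ℝ → ℝ} (hE : IsPrimitiveOn a b E d)
    (hE0 : E a = E b) (hq : IsPrimitiveOn a b q fun x => P.kap x * G x)
    (hG : IntervalIntegrable G volume a b)
    (hd : ∀ x ∈ Ioo a b, d x = (q x - c) / P.kap x) {x : ℝ} (hx : x ∈ Icc a b) :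
    |q x - c| ≤ ∫ s in a..b, P.kap s * |G s| := by
  set K := ∫ s in a..b, P.kap s * |G s| with hK
  have hKi : IntervalIntegrable (fun s => P.kap s * |G s|) volume a b :=
    intervalIntegrable_kap_mul hG.abs
  have hosc : ∀ s ∈ Icc a b, |q s - q x| ≤ K := by
    intro s hs
    rw [hq.sub_eq hx hs]
    rw [← Real.norm_eq_abs]
    refine (intervalIntegral.norm_integral_le_integral_norm_uIoc).trans ?_
    rw [hK, intervalIntegral.integral_of_le hab.le]
    simp_rw [norm_mul, Real.norm_of_nonneg (P.kap_pos _).le, Real.norm_eq_abs]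
    refine setIntegral_mono_set (hKi.1)
      (ae_of_all _ fun t => mul_nonneg (P.kap_pos t).le (abs_nonneg _)) (LE.le.eventuallyLE ?_)
    exact Ioc_subset_Ioc (le_min hx.1 hs.1) (max_le hx.2 hs.2)
  have hint : ∫ s in a..b, d s = 0 := by
    rw [← hE.sub_eq (left_mem_Icc.2 hab.le) (right_mem_Icc.2 hab.le), hE0, sub_self]
  rw [abs_le]
  by_contra hcon
  -- If `|q - c|` exceeded the variation `K` at `x`, then `q - c` would keep its sign on the whole
  -- interval and `d` could not have integral zero.
  rw [not_and_or, not_le, not_le] at hcon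
  rcases hcon with h | h
  · have : 0 < ∫ s in a..b, -d s :=
      intervalIntegral.intervalIntegral_pos_of_pos_on hE.integrable.neg (fun s hs => by
        rw [hd s hs, ← neg_div]
        refine div_pos ?_ (P.kap_pos s)
        have := (abs_le.1 (hosc s (Ioo_subset_Icc_self hs))).2
        linarith) hab
    rw [intervalIntegral.integral_neg, hint] at this
    simp at this
  · have : 0 < ∫ s in a..b, d s :=
      intervalIntegral.intervalIntegral_pos_of_pos_on hE.integrable (fun s hs => by
        rw [hd s hs]
        refine div_pos ?_ (P.kap_pos s)
        have := (abs_le.1 (hosc s (Ioo_subset_Icc_self hs))).1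
        linarith) hab
    rw [hint] at this
    exact lt_irrefl _ this

/-- The interpolation estimate on one element. -/
theorem integral_sq_le_of_element {a b c : ℝ} (hab : a < b) {E d q G : ℝ → ℝ}
    (hE : IsPrimitiveOn a b E d) (hEa : E a = 0) (hEb : E b = 0)
    (hq : IsPrimitiveOn a b q fun x => P.kap x * G x) (hG : IntervalIntegrable G volume a b)
    (hG2 : IntervalIntegrable (fun x => G x ^ 2) volume a b)
    (hd : ∀ x ∈ Ioo a b, d x = (q x - c) / P.kap x) :
    ∫ x in a..b, E x ^ 2 ≤ (P.rho * (b - a) ^ 2) ^ 2 * ∫ x in a..b, G x ^ 2 := by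
  set J := ∫ x in a..b, |G x| with hJ
  have hba : 0 < b - a := sub_pos.2 hab
  have hJ0 : 0 ≤ J := intervalIntegral.integral_nonneg hab.le fun x _ => abs_nonneg _
  -- Division by `κ x` is absorbed by `κ s ≤ ρ κ x` under the integral, so the flux bound becomes
  -- `|E'| ≤ ρ ∫ |G|`.
  have hdb : ∀ x ∈ Ioo a b, |d x| ≤ P.rho * J := by
    intro x hx
    rw [hd x hx, abs_div, abs_of_pos (P.kap_pos x), div_le_iff₀ (P.kap_pos x)]
    refine (abs_flux_sub_le hab hE (hEa.trans hEb.symm) hq hG hd (Ioo_subset_Icc_self hx)).trans ?_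
    have e : P.rho * J * P.kap x = ∫ s in a..b, P.rho * P.kap x * |G s| := by
      rw [intervalIntegral.integral_const_mul]; ring
    rw [e]
    exact intervalIntegral.integral_mono_on hab.le (intervalIntegrable_kap_mul hG.abs)
      (hG.abs.const_mul _) fun s _ => mul_le_mul_of_nonneg_right (P.kap_le s x) (abs_nonneg _)
  have hEx : ∀ x ∈ Icc a b, |E x| ≤ P.rho * J * (b - a) := by
    intro x hx
    rw [hE.eq x hx, hEa, zero_add]
    have h1 : ‖∫ s in a..x, d s‖ ≤ P.rho * J * |x - a| := by
      apply intervalIntegral.norm_integral_le_of_norm_le_const_ae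
      -- The formula for `d` is known on the open interval only, so the point `b` is discarded as a
      -- null set.
      filter_upwards [(by simp [ae_iff, measure_singleton] : ∀ᵐ s : ℝ, s ≠ b)] with s hsb hs
      rw [uIoc_of_le hx.1] at hs
      exact hdb s ⟨hs.1, lt_of_le_of_ne (hs.2.trans hx.2) hsb⟩
    refine h1.trans (mul_le_mul_of_nonneg_left ?_ (mul_nonneg P.rho_nonneg hJ0))
    rw [abs_of_nonneg (sub_nonneg.2 hx.1)]
    linarith [hx.2]
  have h1 : ∫ x in a..b, E x ^ 2 ≤ ∫ _ in a..b, (P.rho * J * (b - a)) ^ 2 := by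
    refine intervalIntegral.integral_mono_on hab.le ?_ (by simp) fun x hx => ?_
    · refine ContinuousOn.intervalIntegrable ?_
      rw [uIcc_of_le hab.le]
      exact (hE.continuousOn hab.le).pow 2
    · rw [← sq_abs]
      exact pow_le_pow_left₀ (abs_nonneg _) (hEx x hx) 2
  rw [intervalIntegral.integral_const, smul_eq_mul] at h1
  have h2 := sq_integral_abs_le hab hG hG2
  rw [← hJ] at h2
  calc ∫ x in a..b, E x ^ 2 ≤ (b - a) * (P.rho * J * (b - a)) ^ 2 := h1
    _ = P.rho ^ 2 * (b - a) ^ 3 * J ^ 2 := by ring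
    _ ≤ P.rho ^ 2 * (b - a) ^ 3 * ((b - a) * ∫ x in a..b, G x ^ 2) :=
      mul_le_mul_of_nonneg_left h2 (by positivity)
    _ = (P.rho * (b - a) ^ 2) ^ 2 * ∫ x in a..b, G x ^ 2 := by ring

/-! ### The immersed nodal basis -/

theorem intervalIntegrable_inv_kap (a b : ℝ) :
    IntervalIntegrable (fun x => (P.kap x)⁻¹) volume a b := by
  rw [intervalIntegrable_iff]
  exact Measure.integrableOn_of_bounded (M := (min P.kp P.km)⁻¹) (by simp)
    P.measurable_kap.inv.aestronglyMeasurable (ae_of_all _ P.norm_inv_kap_le)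

theorem integral_inv_kap (x : ℝ) : ∫ s in (0 : ℝ)..x, (P.kap s)⁻¹ = P.y x := by
  rcases lt_or_ge 0 x with h | h
  · have : ∫ s in (0 : ℝ)..x, (P.kap s)⁻¹ = ∫ _ in (0 : ℝ)..x, P.kp⁻¹ := by
      apply intervalIntegral.integral_congr_ae
      refine ae_of_all _ fun s hs => ?_
      rw [uIoc_of_le h.le] at hs
      rw [kap, if_pos hs.1]
    rw [this, intervalIntegral.integral_const, y, if_pos h, sub_zero, smul_eq_mul, div_eq_mul_inv]
  · have : ∫ s in (0 : ℝ)..x, (P.kap s)⁻¹ = ∫ _ in (0 : ℝ)..x, P.km⁻¹ := by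
      apply intervalIntegral.integral_congr_ae
      refine ae_of_all _ fun s hs => ?_
      rw [uIoc_of_ge h] at hs
      rw [kap, if_neg (not_lt.2 hs.2)]
    rw [this, intervalIntegral.integral_const, y, if_neg (not_lt.2 h), sub_zero, smul_eq_mul,
      div_eq_mul_inv]

theorem isPrimitiveOn_y (a b : ℝ) : IsPrimitiveOn a b P.y fun x => (P.kap x)⁻¹ where
  integrable := intervalIntegrable_inv_kap a b
  eq x _ := by
    rw [← integral_inv_kap, ← integral_inv_kap,
      intervalIntegral.integral_add_adjacent_intervals (intervalIntegrable_inv_kap _ _)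
        (intervalIntegrable_inv_kap _ _)]

theorem y_strictMono : StrictMono P.y := by
  intro a b hab
  have h := (isPrimitiveOn_y (P := P) a b).sub_eq (left_mem_Icc.2 hab.le) (right_mem_Icc.2 hab.le)
  have : 0 < ∫ s in a..b, (P.kap s)⁻¹ :=
    intervalIntegral.intervalIntegral_pos_of_pos_on (intervalIntegrable_inv_kap a b)
      (fun s _ => inv_pos.2 (P.kap_pos s)) hab
  linarith

/-- Both slopes of a nodal function have the form `(y - t) / r`, the falling one with negative `r`.
The derivative `1 / (κ r)` has constant flux, even across the interface. -/
theorem isPrimitiveOn_affine_y (a b r t : ℝ) :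
    IsPrimitiveOn a b (fun x => (P.y x - t) / r) fun x => (P.kap x)⁻¹ / r where
  integrable := (intervalIntegrable_inv_kap a b).div_const r
  eq x hx := by
    rw [intervalIntegral.integral_div, (isPrimitiveOn_y a b).eq x hx]
    ring

theorem isPrimitiveOn_const (a b r : ℝ) : IsPrimitiveOn a b (fun _ => r) fun _ => 0 :=
  ⟨by simp, fun x _ => by simp⟩

theorem h_pos {N : ℕ} (hN : 1 ≤ N) : 0 < P.h N :=
  div_pos (by linarith [P.L_pos]) (by exact_mod_cast hN)

theorem node_strictMono {N : ℕ} (hN : 1 ≤ N) : StrictMono (P.node N) := by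
  intro i j hij
  have : (i : ℝ) < j := by exact_mod_cast hij
  unfold node
  nlinarith [P.h_pos hN]

theorem node_zero (N : ℕ) : P.node N 0 = -P.L := by simp [node]

theorem node_self {N : ℕ} (hN : 1 ≤ N) : P.node N N = P.L := by
  have : (N : ℝ) ≠ 0 := by positivity
  unfold node h
  push_cast
  field_simp
  ring

theorem node_succ_sub (N : ℕ) (i : ℤ) : P.node N (i + 1) - P.node N i = P.h N := by
  unfold node
  push_cast
  ring

theorem node_mem {N : ℕ} (hN : 1 ≤ N) {i : ℤ} (h0 : 0 ≤ i) (h1 : i ≤ N) :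
    P.node N i ∈ Icc (-P.L) P.L := by
  have h2 := (P.node_strictMono hN).monotone h0
  have h3 := (P.node_strictMono hN).monotone h1
  rw [node_zero] at h2
  rw [node_self hN] at h3
  exact ⟨h2, h3⟩

/-- The derivative of the immersed nodal basis function. -/
def dphi (P : Data) (N : ℕ) (i : ℤ) (x : ℝ) : ℝ :=
  if P.node N (i - 1) < x ∧ x ≤ P.node N i then
    (P.kap x)⁻¹ / (P.y (P.node N i) - P.y (P.node N (i - 1)))
  else if P.node N i < x ∧ x ≤ P.node N (i + 1) then
    (P.kap x)⁻¹ / -(P.y (P.node N (i + 1)) - P.y (P.node N i))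
  else 0

section basis

variable {N : ℕ}

theorem y_node_lt (hN : 1 ≤ N) {i j : ℤ} (h : i < j) : P.y (P.node N i) < P.y (P.node N j) :=
  P.y_strictMono (P.node_strictMono hN h)

theorem phi_of_le (hN : 1 ≤ N) (i : ℤ) {x : ℝ} (hx : x ≤ P.node N (i - 1)) : P.phi N i x = 0 := by
  have h1 := P.y_node_lt hN (sub_one_lt i)
  have h2 := P.y_strictMono.monotone hx
  exact max_eq_left (min_le_of_left_le (div_nonpos_of_nonpos_of_nonneg (by linarith) (by linarith)))

theorem phi_of_ge (hN : 1 ≤ N) (i : ℤ) {x : ℝ} (hx : P.node N (i + 1) ≤ x) : P.phi N i x = 0 := by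
  have h1 := P.y_node_lt hN (lt_add_one i)
  have h2 := P.y_strictMono.monotone hx
  exact max_eq_left (min_le_of_right_le (div_nonpos_of_nonpos_of_nonneg (by linarith) (by linarith)))

theorem phi_of_mem_left (hN : 1 ≤ N) (i : ℤ) {x : ℝ} (hx : x ∈ Icc (P.node N (i - 1)) (P.node N i)) :
    P.phi N i x = (P.y x - P.y (P.node N (i - 1))) / (P.y (P.node N i) - P.y (P.node N (i - 1))) := by
  have h1 := P.y_node_lt hN (sub_one_lt i)
  have h2 := P.y_node_lt hN (lt_add_one i)
  have h3 := P.y_strictMono.monotone hx.1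
  have h4 := P.y_strictMono.monotone hx.2
  have h5 : (P.y x - P.y (P.node N (i - 1))) / (P.y (P.node N i) - P.y (P.node N (i - 1))) ≤ 1 :=
    (div_le_one (by linarith)).2 (by linarith)
  -- Left of the node `x_i` the rising quotient is at most 1 and the falling one at least 1, so the
  -- minimum selects the rising one.
  have h6 : 1 ≤ (P.y (P.node N (i + 1)) - P.y x) / (P.y (P.node N (i + 1)) - P.y (P.node N i)) :=
    (one_le_div (by linarith)).2 (by linarith)
  rw [phi, min_eq_left (h5.trans h6), max_eq_right]
  exact div_nonneg (by linarith) (by linarith)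

/-- The falling slope is written with a negative denominator to fit `isPrimitiveOn_affine_y`. -/
theorem phi_of_mem_right (hN : 1 ≤ N) (i : ℤ) {x : ℝ} (hx : x ∈ Icc (P.node N i) (P.node N (i + 1))) :
    P.phi N i x =
      (P.y x - P.y (P.node N (i + 1))) / -(P.y (P.node N (i + 1)) - P.y (P.node N i)) := by
  have h1 := P.y_node_lt hN (sub_one_lt i)
  have h2 := P.y_node_lt hN (lt_add_one i)
  have h3 := P.y_strictMono.monotone hx.1
  have h4 := P.y_strictMono.monotone hx.2
  have h5 : (P.y (P.node N (i + 1)) - P.y x) / (P.y (P.node N (i + 1)) - P.y (P.node N i)) ≤ 1 :=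
    (div_le_one (by linarith)).2 (by linarith)
  have h6 : 1 ≤ (P.y x - P.y (P.node N (i - 1))) / (P.y (P.node N i) - P.y (P.node N (i - 1))) :=
    (one_le_div (by linarith)).2 (by linarith)
  rw [phi, min_eq_right (h5.trans h6), max_eq_right, div_neg, ← neg_div, neg_sub]
  exact div_nonneg (by linarith) (by linarith)

theorem phi_node (hN : 1 ≤ N) (i j : ℤ) : P.phi N i (P.node N j) = if j = i then 1 else 0 := by
  have hm := (P.node_strictMono hN).monotone
  rcases lt_trichotomy j i with h | rfl | h
  · rw [if_neg h.ne, phi_of_le hN i (hm (Int.le_sub_one_of_lt h))]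
  · rw [if_pos rfl, phi_of_mem_left hN j ⟨hm (sub_one_lt j).le, le_rfl⟩, div_self]
    exact (sub_pos.2 (P.y_node_lt hN (sub_one_lt j))).ne'
  · rw [if_neg h.ne', phi_of_ge hN i (hm h)]

/-- For interior `i` the nodes `x_{i-1}, x_i, x_{i+1}` lie in the closed domain and cut it into four
pieces, on each of which the function is zero or affine in `y`. -/
theorem isPrimitiveOn_phi (hN : 1 ≤ N) (i : ℤ) (hi : 1 ≤ i ∧ i ≤ N - 1) :
    IsPrimitiveOn (-P.L) P.L (P.phi N i) (P.dphi N i) := by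
  have hs := P.node_strictMono hN
  have h0 := hs.monotone (show (0 : ℤ) ≤ i - 1 by omega)
  have h1 := hs (sub_one_lt i)
  have h2 := hs (lt_add_one i)
  have h3 := hs.monotone (show i + 1 ≤ (N : ℤ) by omega)
  rw [node_zero] at h0
  rw [node_self hN] at h3
  have p1 : IsPrimitiveOn (-P.L) (P.node N (i - 1)) (P.phi N i) (P.dphi N i) :=
    (isPrimitiveOn_const _ _ 0).congr h0 (fun x hx => phi_of_le hN i hx.2) fun x hx => by
      rw [dphi, if_neg fun h => not_lt.2 hx.2 h.1, if_neg fun h => not_lt.2 (hx.2.trans h1.le) h.1]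
  have p2 : IsPrimitiveOn (P.node N (i - 1)) (P.node N i) (P.phi N i) (P.dphi N i) :=
    (isPrimitiveOn_affine_y _ _ _ _).congr h1.le (fun x hx => phi_of_mem_left hN i hx) fun x hx => by
      rw [dphi, if_pos ⟨hx.1, hx.2⟩]
  have p3 : IsPrimitiveOn (P.node N i) (P.node N (i + 1)) (P.phi N i) (P.dphi N i) :=
    (isPrimitiveOn_affine_y _ _ _ _).congr h2.le (fun x hx => phi_of_mem_right hN i hx) fun x hx => by
      rw [dphi, if_neg fun h => not_le.2 hx.1 h.2, if_pos ⟨hx.1, hx.2⟩]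
  have p4 : IsPrimitiveOn (P.node N (i + 1)) P.L (P.phi N i) (P.dphi N i) :=
    (isPrimitiveOn_const _ _ 0).congr h3 (fun x hx => phi_of_ge hN i hx.1) fun x hx => by
      rw [dphi, if_neg fun h => not_le.2 (h2.trans hx.1) h.2, if_neg fun h => not_le.2 hx.1 h.2]
  exact ((p1.glue p2 h0).glue p3 (h0.trans h1.le)).glue p4 ((h0.trans h1.le).trans h2.le)

theorem measurable_dphi (i : ℤ) : Measurable (P.dphi N i) :=
  Measurable.ite measurableSet_Ioc (P.measurable_kap.inv.div_const _)
    (Measurable.ite measurableSet_Ioc (P.measurable_kap.inv.div_const _) measurable_const)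

theorem norm_dphi_le (i : ℤ) (x : ℝ) :
    ‖P.dphi N i x‖ ≤ (min P.kp P.km)⁻¹ / |P.y (P.node N i) - P.y (P.node N (i - 1))| +
      (min P.kp P.km)⁻¹ / |P.y (P.node N (i + 1)) - P.y (P.node N i)| := by
  have h0 : 0 ≤ (min P.kp P.km)⁻¹ := (norm_nonneg _).trans (P.norm_inv_kap_le x)
  have h1 : ∀ r : ℝ, 0 ≤ (min P.kp P.km)⁻¹ / |r| := fun r => div_nonneg h0 (abs_nonneg r)
  have h2 : ∀ r : ℝ, ‖(P.kap x)⁻¹ / r‖ ≤ (min P.kp P.km)⁻¹ / |r| := fun r => by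
    rw [norm_div, Real.norm_eq_abs r]
    exact div_le_div_of_nonneg_right (P.norm_inv_kap_le x) (abs_nonneg r)
  unfold dphi
  split_ifs
  · exact (h2 _).trans (le_add_of_nonneg_right (h1 _))
  · refine (h2 _).trans ?_
    rw [abs_neg]
    exact le_add_of_nonneg_left (h1 _)
  · rw [norm_zero]
    exact add_nonneg (h1 _) (h1 _)

theorem hasGrad_phi (hN : 1 ≤ N) (i : ℤ) (hi : 1 ≤ i ∧ i ≤ N - 1) :
    P.HasGrad (P.phi N i) (P.dphi N i) where
  memLp := MemLp.of_bound (measurable_dphi i).aestronglyMeasurable _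
    (ae_of_all _ (norm_dphi_le i))
  prim := isPrimitiveOn_phi hN i hi
  left := by rw [← node_zero N, phi_node hN, if_neg (by omega)]
  right := by
    have h := phi_node (P := P) hN i N
    rwa [node_self hN, if_neg (by omega)] at h

/-! ### Elementwise constant flux, nodal interpolation and Ritz orthogonality. -/

/-- `W` is a finite element function with the derivative `d`: the flux is constant on every
element. -/
structure IsElementwise (P : Data) (N : ℕ) (W d : ℝ → ℝ) : Prop where
  hasGrad : P.HasGrad W d
  const : ∀ j : ℕ, j < N → ∃ c : ℝ, ∀ x ∈ Ioo (P.node N j) (P.node N (j + 1)), P.kap x * d x = c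

theorem isElementwise_phi (hN : 1 ≤ N) (i : ℤ) (hi : 1 ≤ i ∧ i ≤ N - 1) :
    P.IsElementwise N (P.phi N i) (P.dphi N i) where
  hasGrad := hasGrad_phi hN i hi
  const j _ := by
    have hs := P.node_strictMono hN
    rcases lt_trichotomy (j : ℤ) i with h | h | h
    · rcases (Int.le_sub_one_of_lt h).lt_or_eq with h' | h'
      · refine ⟨0, fun x hx => ?_⟩
        have h1 := hs.monotone (Int.add_one_le_iff.2 h')
        have h2 := hs (sub_one_lt i)
        rw [dphi, if_neg fun h => by linarith [h.1, hx.2], if_neg fun h => by linarith [h.1, hx.2],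
          mul_zero]
      · refine ⟨(P.y (P.node N i) - P.y (P.node N (i - 1)))⁻¹, fun x hx => ?_⟩
        rw [h', sub_add_cancel] at hx
        rw [dphi, if_pos ⟨hx.1, hx.2.le⟩, div_eq_mul_inv, mul_inv_cancel_left₀ (P.kap_pos x).ne']
    · refine ⟨(-(P.y (P.node N (i + 1)) - P.y (P.node N i)))⁻¹, fun x hx => ?_⟩
      rw [h] at hx
      rw [dphi, if_neg fun h => by linarith [h.2, hx.1], if_pos ⟨hx.1, hx.2.le⟩, div_eq_mul_inv,
        mul_inv_cancel_left₀ (P.kap_pos x).ne']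
    · refine ⟨0, fun x hx => ?_⟩
      have h1 := hs.monotone (Int.add_one_le_iff.2 h)
      have h2 := hs (lt_add_one i)
      rw [dphi, if_neg fun h => by linarith [h.2, hx.1], if_neg fun h => by linarith [h.2, hx.1],
        mul_zero]

/-- Elementwise constancy of the flux is preserved by linear combinations, so it passes from the
basis to its span. -/
theorem exists_isElementwise (hN : 1 ≤ N) {W : ℝ → ℝ} (hW : W ∈ P.Sh N) :
    ∃ d, P.IsElementwise N W d := by
  induction hW using Submodule.span_induction with
  | mem W h =>
    obtain ⟨i, hi, rfl⟩ := h
    exact ⟨_, isElementwise_phi hN i hi⟩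
  | zero =>
    refine ⟨fun _ => 0, ⟨?_, isPrimitiveOn_const _ _ 0, rfl, rfl⟩, fun j _ => ⟨0, fun x _ => mul_zero _⟩⟩
    exact MemLp.zero'
  | add V W _ _ hV hW =>
    obtain ⟨d, hd⟩ := hV
    obtain ⟨e, he⟩ := hW
    refine ⟨_, hd.hasGrad.add he.hasGrad, fun j hj => ?_⟩
    obtain ⟨r, hr⟩ := hd.const j hj
    obtain ⟨t, ht⟩ := he.const j hj
    exact ⟨r + t, fun x hx => by rw [mul_add, hr x hx, ht x hx]⟩
  | smul r W _ hW =>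
    obtain ⟨e, he⟩ := hW
    refine ⟨_, he.hasGrad.const_mul r, fun j hj => ?_⟩
    obtain ⟨t, ht⟩ := he.const j hj
    exact ⟨r * t, fun x hx => by rw [mul_left_comm, ht x hx]⟩

/-- The coefficients are the values at the interior nodes. At the two boundary nodes every basis
function vanishes, which is why `V` must vanish there. -/
theorem exists_interpolant (hN : 1 ≤ N) {V : ℝ → ℝ} (hl : V (-P.L) = 0) (hr : V P.L = 0) :
    ∃ I ∈ P.Sh N, ∀ j : ℕ, j ≤ N → I (P.node N j) = V (P.node N j) := by
  refine ⟨∑ i ∈ Finset.Icc (1 : ℤ) (N - 1), V (P.node N i) • P.phi N i,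
    Submodule.sum_mem _ fun i hi => Submodule.smul_mem _ _
      (Submodule.subset_span ⟨i, Finset.mem_Icc.1 hi, rfl⟩), fun j hj => ?_⟩
  simp only [Finset.sum_apply, Pi.smul_apply, smul_eq_mul, phi_node hN, mul_ite, mul_one, mul_zero]
  rw [Finset.sum_ite_eq]
  split_ifs with h
  · rfl
  · rw [Finset.mem_Icc] at h
    have : (j : ℤ) = 0 ∨ (j : ℤ) = N := by omega
    rcases this with h' | h'
    · rw [h', node_zero, hl]
    · rw [h', node_self hN, hr]

theorem sum_elements (hN : 1 ≤ N) {f : ℝ → ℝ} (hf : IntervalIntegrable f volume (-P.L) P.L) :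
    ∑ j ∈ Finset.range N, ∫ x in (P.node N j)..(P.node N (j + 1)), f x =
      ∫ x in (-P.L)..P.L, f x := by
  have h := intervalIntegral.sum_integral_adjacent_intervals (f := f) (μ := volume)
    (a := fun j : ℕ => P.node N j) (n := N) (fun k hk => by
      refine hf.mono_set ?_
      rw [uIcc_of_le P.neg_L_lt.le]
      exact uIcc_subset_Icc (node_mem hN (by omega) (by omega)) (node_mem hN (by omega) (by omega)))
  simp only [Nat.cast_zero, node_zero, node_self hN] at h
  rw [← h]
  simp

/-- Functions vanishing at the nodes are orthogonal to the finite element space. -/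
theorem IsElementwise.integral_eq_zero (hN : 1 ≤ N) {W e E d : ℝ → ℝ} (hW : P.IsElementwise N W e)
    (hE : P.HasGrad E d) (h0 : ∀ j : ℕ, j ≤ N → E (P.node N j) = 0) :
    ∫ x, P.kap x * d x * e x ∂P.vol = 0 := by
  rw [integral_vol, ← sum_elements hN (P.intervalIntegrable_of_vol (hE.integrable_mul hW.hasGrad))]
  refine Finset.sum_eq_zero fun j hj => ?_
  have hj' := Finset.mem_range.1 hj
  obtain ⟨c, hc⟩ := hW.const j hj'
  have hlt := P.node_strictMono hN (lt_add_one (j : ℤ))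
  -- The constant flux `c` of `W` leaves the integral, and `∫ d` is an increment of `E` between two
  -- nodes.
  have h1 : ∫ x in (P.node N j)..(P.node N (j + 1)), P.kap x * d x * e x =
      ∫ x in (P.node N j)..(P.node N (j + 1)), c * d x := by
    apply intervalIntegral.integral_congr_ae
    filter_upwards [(by simp [ae_iff, measure_singleton] :
      ∀ᵐ s : ℝ, s ≠ P.node N (j + 1))] with s hsb hs
    rw [uIoc_of_le hlt.le] at hs
    rw [← hc s ⟨hs.1, lt_of_le_of_ne hs.2 hsb⟩]
    ring
  have h2 := h0 (j + 1) hj'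
  push_cast at h2
  rw [h1, intervalIntegral.integral_const_mul, ← hE.prim.sub_eq (node_mem hN (by omega) (by omega))
    (node_mem hN (by omega) (by omega)), h2, h0 j hj'.le, sub_self, mul_zero]

/-- The interpolation error. -/
theorem HasFlux.integral_sq_sub_le (hN : 1 ≤ N) {V q G W e : ℝ → ℝ} (hV : P.HasFlux V q G)
    (hW : P.IsElementwise N W e) (h0 : ∀ j : ℕ, j ≤ N → V (P.node N j) = W (P.node N j)) :
    ∫ x, (V x - W x) ^ 2 ∂P.vol ≤ (P.rho * P.h N ^ 2) ^ 2 * ∫ x, G x ^ 2 ∂P.vol := by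
  have hE := hV.hasGrad.sub hW.hasGrad
  have hG := P.intervalIntegrable_of_vol (hV.memLp.integrable (by norm_num))
  have hG2 := P.intervalIntegrable_of_vol hV.memLp.integrable_sq
  have hE2 := P.intervalIntegrable_of_vol hE.memLp_self.integrable_sq
  rw [integral_vol, integral_vol, ← sum_elements hN hE2, ← sum_elements hN hG2, Finset.mul_sum]
  refine Finset.sum_le_sum fun j hj => ?_
  have hj' := Finset.mem_range.1 hj
  obtain ⟨c, hc⟩ := hW.const j hj'
  have hlt := P.node_strictMono hN (lt_add_one (j : ℤ))
  have ha : P.node N j ∈ Icc (-P.L) P.L := node_mem hN (by omega) (by omega)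
  have hb : P.node N (j + 1) ∈ Icc (-P.L) P.L := node_mem hN (by omega) (by omega)
  have hsub : uIcc (P.node N j) (P.node N (j + 1)) ⊆ uIcc (-P.L) P.L := by
    rw [uIcc_of_le P.neg_L_lt.le]
    exact uIcc_subset_Icc ha hb
  have h2 := h0 (j + 1) hj'
  push_cast at h2
  -- With `c` the constant flux of `W`, the error derivative is `(q - c) / κ`; the element
  -- containing the interface needs no separate treatment.
  have h := integral_sq_le_of_element (c := c) hlt (hE.prim.mono ha hb)
    (by rw [h0 j hj'.le, sub_self]) (by rw [h2, sub_self]) (hV.flux.mono ha hb)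
    (hG.mono_set hsub) (hG2.mono_set hsub) (fun x hx => by
      rw [sub_div, ← hc x hx, mul_div_cancel_left₀ _ (P.kap_pos x).ne'])
  rwa [node_succ_sub] at h

end basis

end Data

/-! ### The trapezoidal rule -/

/-- The Peano kernel formula for the trapezoidal rule. -/
theorem trapezoid_eq {a b : ℝ} (hab : a ≤ b) {F f g r : ℝ → ℝ} (hF : IsPrimitiveOn a b F f)
    (hf : IsPrimitiveOn a b f g) (hg : IsPrimitiveOn a b g r) :
    F b - F a - (b - a) / 2 * (f a + f b) = -∫ t in a..b, r t * ((t - a) * (b - t) / 2) := by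
  -- Two integrations by parts: the primitive of 1 centred at the midpoint produces the trapezoidal
  -- weights, and the second kernel `(t - a)(b - t) / 2` vanishes at both ends.
  have hm : IsPrimitiveOn a b (fun t => t - (a + b) / 2) fun _ => 1 := by
    have h := IsPrimitiveOn.of_contDiff (F := fun t => t - (a + b) / 2) a b
      (contDiff_id.sub contDiff_const)
    have e : deriv (fun t : ℝ => t - (a + b) / 2) = fun _ => 1 := by
      ext t
      simp
    rwa [e] at h
  have hk : IsPrimitiveOn a b (fun t => (t - a) * (b - t) / 2) fun t => -(t - (a + b) / 2) := by
    have h := IsPrimitiveOn.of_contDiff (F := fun t => (t - a) * (b - t) / 2) a b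
      (((contDiff_id.sub contDiff_const).mul (contDiff_const.sub contDiff_id)).div_const _)
    have e : deriv (fun t : ℝ => (t - a) * (b - t) / 2) = fun t => -(t - (a + b) / 2) := by
      ext t
      have h1 : HasDerivAt (fun t : ℝ => (t - a) * (b - t) / 2)
          ((1 * (b - t) + (t - a) * (-1)) / 2) t :=
        (((hasDerivAt_id t).sub_const a).mul ((hasDerivAt_id t).const_sub b)).div_const 2
      rw [h1.deriv]
      ring
    rwa [e] at h
  have h1 := hf.integral_mul hm hab
  have h2 := hg.integral_mul hk hab
  have h3 := hF.sub_eq (left_mem_Icc.2 hab) (right_mem_Icc.2 hab)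
  simp only [mul_one] at h1
  simp only [mul_neg, intervalIntegral.integral_neg] at h2
  rw [h3, h1]
  linarith

/-- The Peano kernel is largest at the midpoint, with value `(b - a)² / 8`. The majorant `R` leaves
room for Cauchy–Schwarz when `r` is an inner product. -/
theorem abs_trapezoid_le {a b : ℝ} (hab : a ≤ b) {F f g r R : ℝ → ℝ} (hF : IsPrimitiveOn a b F f)
    (hf : IsPrimitiveOn a b f g) (hg : IsPrimitiveOn a b g r)
    (hR : IntervalIntegrable R volume a b) (hrR : ∀ t, |r t| ≤ R t) :
    |F b - F a - (b - a) / 2 * (f a + f b)| ≤ (b - a) ^ 2 / 8 * ∫ t in a..b, R t := by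
  rw [trapezoid_eq hab hF hf hg, abs_neg, ← intervalIntegral.integral_const_mul]
  refine (intervalIntegral.abs_integral_le_integral_abs hab).trans ?_
  refine intervalIntegral.integral_mono_on hab ?_ (hR.const_mul _) fun t ht => ?_
  · exact (hg.integrable.mul_continuousOn (by fun_prop)).abs
  · have h1 : 0 ≤ (t - a) * (b - t) := mul_nonneg (sub_nonneg.2 ht.1) (sub_nonneg.2 ht.2)
    have h2 : (t - a) * (b - t) / 2 ≤ (b - a) ^ 2 / 8 := by
      nlinarith [sq_nonneg ((t - a) - (b - t))]
    rw [abs_mul, abs_of_nonneg (div_nonneg h1 two_pos.le), mul_comm]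
    exact mul_le_mul h2 (hrR t) (abs_nonneg _) (by positivity)

/-- Norm bounds in `L²(Ω)` thus follow from scalar estimates of the pairing of a vector with itself.
-/
theorem norm_le_of_inner_le {E : Type*} [NormedAddCommGroup E] [InnerProductSpace ℝ E] {x : E}
    {K : ℝ} (h : inner ℝ x x ≤ K * ‖x‖) (hK : 0 ≤ K) : ‖x‖ ≤ K := by
  rw [real_inner_self_eq_norm_sq] at h
  rcases (norm_nonneg x).eq_or_lt with h0 | h0
  · rwa [← h0]
  · nlinarith

namespace Data

variable {P : Data}

/-! ### The Hilbert space `L²(Ω)` -/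

theorem inner_eq_integral {f g : P.L2} {F G : ℝ → ℝ} (hf : f =ᵐ[P.vol] F) (hg : g =ᵐ[P.vol] G) :
    inner ℝ f g = ∫ x, F x * G x ∂P.vol := by
  rw [L2.inner_def]
  apply integral_congr_ae
  filter_upwards [hf, hg] with x h1 h2
  rw [h1, h2]
  simp [mul_comm]

theorem norm_eq_sqrt {f : P.L2} {F : ℝ → ℝ} (hf : f =ᵐ[P.vol] F) :
    ‖f‖ = Real.sqrt (∫ x, F x ^ 2 ∂P.vol) := by
  simp_rw [sq]
  rw [← inner_eq_integral hf hf, real_inner_self_eq_norm_sq, Real.sqrt_sq (norm_nonneg _)]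

theorem l2norm_eq_norm {f : P.L2} {F : ℝ → ℝ} (hf : f =ᵐ[P.vol] F) : P.l2norm F = ‖f‖ := by
  rw [l2norm, Lp.norm_def, eLpNorm_congr_ae hf]

theorem l2norm_eq_sqrt {F : ℝ → ℝ} (hF : MemLp F 2 P.vol) :
    P.l2norm F = Real.sqrt (∫ x, F x ^ 2 ∂P.vol) := by
  rw [l2norm_eq_norm hF.coeFn_toLp, norm_eq_sqrt hF.coeFn_toLp]

theorem l2norm_nonneg (F : ℝ → ℝ) : 0 ≤ P.l2norm F := ENNReal.toReal_nonneg

theorem l2norm_add_le {F G : ℝ → ℝ} (hF : MemLp F 2 P.vol) (hG : MemLp G 2 P.vol) :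
    P.l2norm (fun x => F x + G x) ≤ P.l2norm F + P.l2norm G := by
  rw [l2norm_eq_norm hF.coeFn_toLp, l2norm_eq_norm hG.coeFn_toLp,
    l2norm_eq_norm (f := hF.toLp + hG.toLp)]
  · exact norm_add_le _ _
  · filter_upwards [Lp.coeFn_add (hF.toLp) (hG.toLp), hF.coeFn_toLp, hG.coeFn_toLp] with x h1 h2 h3
    rw [h1, Pi.add_apply, h2, h3]

/-! ### Time derivatives -/

namespace IsTimeDeriv

variable {T : ℝ} {u w : ℝ → P.L2}

/-- Pairing with a fixed vector commutes with the Bochner integral, so scalar calculus applies to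
`u`. -/
theorem isPrimitiveOn_inner (h : P.IsTimeDeriv T u w) (hT : 0 ≤ T) (z : P.L2) :
    IsPrimitiveOn 0 T (fun t => inner ℝ z (u t)) fun t => inner ℝ z (w t) where
  integrable := by
    have := h.1
    rw [intervalIntegrable_iff] at this ⊢
    exact this.const_inner z
  eq x hx := by
    have hi : IntervalIntegrable w volume 0 x := h.1.mono_set (by
      rw [uIcc_of_le hx.1, uIcc_of_le hT]
      exact Icc_subset_Icc_right hx.2)
    rw [h.2 x hx, inner_add_right]
    congr 1
    exact ((innerSL ℝ z).intervalIntegral_comp_comm hi).symm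

end IsTimeDeriv

/-- The error of the trapezoidal rule for `u = ∫ ∂ₜu`. -/
theorem norm_trapezoid_le {T a b : ℝ} {u u₁ u₂ u₃ : ℝ → P.L2} (h₁ : P.IsTimeDeriv T u u₁)
    (h₂ : P.IsTimeDeriv T u₁ u₂) (h₃ : P.IsTimeDeriv T u₂ u₃) (ha : 0 ≤ a) (hab : a ≤ b)
    (hb : b ≤ T) :
    ‖u b - u a - ((b - a) / 2) • (u₁ a + u₁ b)‖ ≤ (b - a) ^ 2 / 8 * ∫ t in a..b, ‖u₃ t‖ := by
  have hT : 0 ≤ T := ha.trans (hab.trans hb)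
  have ha' : a ∈ Icc 0 T := ⟨ha, hab.trans hb⟩
  have hb' : b ∈ Icc 0 T := ⟨ha.trans hab, hb⟩
  have hi : IntervalIntegrable (fun t => ‖u₃ t‖) volume a b := h₃.1.norm.mono_set (by
    rw [uIcc_of_le hT]
    exact uIcc_subset_Icc ha' hb')
  -- The scalar trapezoidal estimate is applied to the pairing with the error vector itself.
  set z := u b - u a - ((b - a) / 2) • (u₁ a + u₁ b) with hz
  refine norm_le_of_inner_le ?_ (mul_nonneg (by positivity)
    (intervalIntegral.integral_nonneg hab fun t _ => norm_nonneg _))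
  have h := abs_trapezoid_le hab ((h₁.isPrimitiveOn_inner hT z).mono ha' hb')
    ((h₂.isPrimitiveOn_inner hT z).mono ha' hb') ((h₃.isPrimitiveOn_inner hT z).mono ha' hb')
    (hi.const_mul ‖z‖) (fun t => abs_real_inner_le_norm _ _)
  rw [intervalIntegral.integral_const_mul] at h
  have e : inner ℝ z z = inner ℝ z (u b) - inner ℝ z (u a)
      - (b - a) / 2 * (inner ℝ z (u₁ a) + inner ℝ z (u₁ b)) := by
    have e' : ∀ y : P.L2, inner ℝ y (u b - u a - ((b - a) / 2) • (u₁ a + u₁ b)) =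
        inner ℝ y (u b) - inner ℝ y (u a)
          - (b - a) / 2 * (inner ℝ y (u₁ a) + inner ℝ y (u₁ b)) := fun y => by
      rw [inner_sub_right, inner_sub_right, inner_smul_right, inner_add_right]
    exact e' z
  rw [e]
  refine (le_abs_self _).trans (h.trans (le_of_eq ?_))
  ring

/-! ### The broken seminorm of a time integral -/

/-- `φ` is a test function on `(a, b)`. -/
structure IsTest (a b : ℝ) (φ : ℝ → ℝ) : Prop where
  contDiff : ContDiff ℝ (⊤ : ℕ∞) φ
  compact : HasCompactSupport φ
  supp : tsupport φ ⊆ Ioo a b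

namespace IsTest

variable {a b : ℝ} {φ ψ : ℝ → ℝ}

theorem add (hφ : IsTest a b φ) (hψ : IsTest a b ψ) : IsTest a b fun x => φ x + ψ x :=
  ⟨hφ.contDiff.add hψ.contDiff, hφ.compact.add hψ.compact,
    (tsupport_add φ ψ).trans (union_subset hφ.supp hψ.supp)⟩

theorem const_mul (r : ℝ) (hφ : IsTest a b φ) : IsTest a b fun x => r * φ x :=
  ⟨contDiff_const.mul hφ.contDiff, hφ.compact.mul_left, tsupport_mul_subset_right.trans hφ.supp⟩

theorem zero (a b : ℝ) : IsTest a b fun _ => 0 :=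
  ⟨contDiff_const, HasCompactSupport.zero, by simp [tsupport]⟩

theorem deriv (hφ : IsTest a b φ) : IsTest a b (deriv φ) :=
  ⟨(contDiff_infty_iff_deriv.1 hφ.contDiff).2, hφ.compact.deriv,
    Subset.trans (tsupport_deriv_subset (𝕜 := ℝ)) hφ.supp⟩

theorem iteratedDeriv_two (hφ : IsTest a b φ) : IsTest a b (iteratedDeriv 2 φ) := by
  rw [show iteratedDeriv 2 φ = _root_.deriv (_root_.deriv φ) by
    rw [iteratedDeriv_succ, iteratedDeriv_one]]
  exact hφ.deriv.deriv

theorem eq_zero (hφ : IsTest a b φ) {x : ℝ} (hx : x ∉ Ioo a b) : φ x = 0 :=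
  image_eq_zero_of_notMem_tsupport fun hx' => hx (hφ.supp hx')

theorem memLp (hφ : IsTest a b φ) : MemLp φ 2 P.vol :=
  P.memLp_of_continuousOn hφ.contDiff.continuous.continuousOn

end IsTest

theorem integral_mul_test {f φ ψ : ℝ → ℝ} (hf : MemLp f 2 P.vol) (hφ : IsTest (-P.L) 0 φ)
    (hψ : IsTest 0 P.L ψ) :
    ∫ x, f x * (φ x + ψ x) ∂P.vol =
      (∫ x in Ioo (-P.L) 0, f x * φ x) + ∫ x in Ioo 0 P.L, f x * ψ x := by
  have hi : Integrable (fun x => f x * (φ x + ψ x)) P.vol :=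
    hf.integrable_mul (hφ.memLp.add hψ.memLp)
  rw [vol_eq_add] at hi ⊢
  rw [integral_add_measure hi.left_of_add_measure hi.right_of_add_measure]
  congr 1
  · refine setIntegral_congr_fun measurableSet_Ioo fun x hx => ?_
    rw [hψ.eq_zero fun h => lt_asymm h.1 hx.2, add_zero]
  · refine setIntegral_congr_fun measurableSet_Ioo fun x hx => ?_
    rw [hφ.eq_zero fun h => lt_asymm h.2 hx.1, zero_add]

/-- Moving both derivatives onto the test functions turns a pairing with the second derivative into
an `L²` pairing with `v` itself, which commutes with time integration. -/
theorem integral_mul_iteratedDeriv_test {v G φ ψ : ℝ → ℝ} (hv : MemLp v 2 P.vol)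
    (hG : MemLp G 2 P.vol) (hl : IsWeakDeriv 2 (-P.L) 0 v G) (hr : IsWeakDeriv 2 0 P.L v G)
    (hφ : IsTest (-P.L) 0 φ) (hψ : IsTest 0 P.L ψ) :
    ∫ x, v x * (iteratedDeriv 2 φ x + iteratedDeriv 2 ψ x) ∂P.vol =
      ∫ x, G x * (φ x + ψ x) ∂P.vol := by
  rw [integral_mul_test hv hφ.iteratedDeriv_two hψ.iteratedDeriv_two, integral_mul_test hG hφ hψ,
    hl φ hφ.contDiff hφ.compact hφ.supp, hr ψ hψ.contDiff hψ.compact hψ.supp]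
  ring

/-- Sums of test functions on `(-L, 0)` and on `(0, L)`. -/
def testSpace (P : Data) : Submodule ℝ P.L2 where
  carrier := {f | ∃ φ ψ, IsTest (-P.L) 0 φ ∧ IsTest 0 P.L ψ ∧ f =ᵐ[P.vol] fun x => φ x + ψ x}
  add_mem' := by
    rintro f g ⟨φ, ψ, hφ, hψ, hf⟩ ⟨φ', ψ', hφ', hψ', hg⟩
    refine ⟨_, _, hφ.add hφ', hψ.add hψ', ?_⟩
    filter_upwards [Lp.coeFn_add f g, hf, hg] with x h1 h2 h3
    rw [h1, Pi.add_apply, h2, h3]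
    ring
  zero_mem' := ⟨_, _, IsTest.zero _ _, IsTest.zero _ _, by
    filter_upwards [Lp.coeFn_zero ℝ 2 P.vol] with x hx
    rw [hx]
    simp⟩
  smul_mem' := by
    rintro r f ⟨φ, ψ, hφ, hψ, hf⟩
    refine ⟨_, _, hφ.const_mul r, hψ.const_mul r, ?_⟩
    filter_upwards [Lp.coeFn_smul r f, hf] with x h1 h2
    rw [h1, Pi.smul_apply, h2, smul_eq_mul]
    ring

/-- An orthogonal element vanishes on each half by the fundamental lemma, and the interface is null.
-/
theorem testSpace_dense : Dense (P.testSpace : Set P.L2) := by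
  rw [Submodule.dense_iff_topologicalClosure_eq_top, Submodule.topologicalClosure_eq_top_iff,
    Submodule.eq_bot_iff]
  intro f hf
  rw [Submodule.mem_orthogonal'] at hf
  have key : ∀ φ ψ, IsTest (-P.L) 0 φ → IsTest 0 P.L ψ →
      (∫ x in Ioo (-P.L) 0, f x * φ x) + ∫ x in Ioo 0 P.L, f x * ψ x = 0 := by
    intro φ ψ hφ hψ
    have hm : MemLp (fun x => φ x + ψ x) 2 P.vol := hφ.memLp.add hψ.memLp
    have h := hf hm.toLp ⟨φ, ψ, hφ, hψ, hm.coeFn_toLp⟩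
    rwa [inner_eq_integral EventuallyEq.rfl hm.coeFn_toLp, integral_mul_test (Lp.memLp f) hφ hψ] at h
  rw [Lp.eq_zero_iff_ae_eq_zero]
  refine ae_eq_vol ?_ ?_
  · refine ae_eq_zero_of_forall_test
      (integrableOn_of_memLp_two ((Lp.memLp f).mono_measure P.vol_left_le)) fun φ h1 h2 h3 => ?_
    simpa using key φ _ ⟨h1, h2, h3⟩ (IsTest.zero _ _)
  · refine ae_eq_zero_of_forall_test
      (integrableOn_of_memLp_two ((Lp.memLp f).mono_measure P.vol_right_le)) fun φ h1 h2 h3 => ?_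
    simpa using key _ φ (IsTest.zero _ _) ⟨h1, h2, h3⟩

/-- The broken second derivative. -/
theorem MemBroken.exists_second {v : ℝ → ℝ} (hv : P.MemBroken 2 v) :
    ∃ G, MemLp G 2 P.vol ∧ IsWeakDeriv 2 (-P.L) 0 v G ∧ IsWeakDeriv 2 0 P.L v G ∧
      P.semiH2 v = Real.sqrt (∫ x, G x ^ 2 ∂P.vol) := by
  obtain ⟨m, d⟩ := (hv.left.2 2 (by norm_num) le_rfl).weakDeriv_spec
  obtain ⟨n, e⟩ := (hv.right.2 2 (by norm_num) le_rfl).weakDeriv_spec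
  have hG := memLp_ite m n
  have h1 : weakDeriv 2 (-P.L) 0 v =ᵐ[volume.restrict (Ioo (-P.L) 0)]
      fun x => if 0 < x then weakDeriv 2 0 P.L v x else weakDeriv 2 (-P.L) 0 v x := by
    filter_upwards [ae_restrict_mem measurableSet_Ioo] with x hx
    rw [if_neg (not_lt.2 hx.2.le)]
  have h2 : weakDeriv 2 0 P.L v =ᵐ[volume.restrict (Ioo 0 P.L)]
      fun x => if 0 < x then weakDeriv 2 0 P.L v x else weakDeriv 2 (-P.L) 0 v x := by
    filter_upwards [ae_restrict_mem measurableSet_Ioo] with x hx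
    rw [if_pos hx.1]
  refine ⟨_, hG, d.congr EventuallyEq.rfl h1, e.congr EventuallyEq.rfl h2, ?_⟩
  have hi := hG.integrable_sq
  rw [vol_eq_add] at hi ⊢
  rw [integral_add_measure hi.left_of_add_measure hi.right_of_add_measure, semiH2]
  congr 2
  · exact integral_congr_ae (h1.fun_comp (· ^ 2))
  · exact integral_congr_ae (h2.fun_comp (· ^ 2))

theorem semiH2_nonneg (v : ℝ → ℝ) : 0 ≤ P.semiH2 v := Real.sqrt_nonneg _

/-- The seminorm of an increment is bounded by the integral of the seminorm of `∂ₜu`. -/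
theorem sqrt_integral_sq_sub_le {T a b : ℝ} {u u₁ : ℝ → P.L2} (h₁ : P.IsTimeDeriv T u u₁)
    (hH : P.MemL1H2 T u₁) (ha : 0 ≤ a) (hab : a ≤ b) (hb : b ≤ T)
    {V q G V' q' G' : ℝ → ℝ} (hV : P.HasFlux V q G) (hV' : P.HasFlux V' q' G')
    (hua : u a =ᵐ[P.vol] V) (hub : u b =ᵐ[P.vol] V') :
    Real.sqrt (∫ x, (G' x - G x) ^ 2 ∂P.vol) ≤ ∫ s in a..b, P.semiH2 (u₁ s) := by
  have hT : 0 ≤ T := ha.trans (hab.trans hb)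
  have ha' : a ∈ Icc 0 T := ⟨ha, hab.trans hb⟩
  have hb' : b ∈ Icc 0 T := ⟨ha.trans hab, hb⟩
  have hi : IntervalIntegrable (fun t => P.semiH2 (u₁ t)) volume a b := hH.2.mono_set (by
    rw [uIcc_of_le hT]
    exact uIcc_subset_Icc ha' hb')
  set K := ∫ s in a..b, P.semiH2 (u₁ s) with hK
  have hK0 : 0 ≤ K := intervalIntegral.integral_nonneg hab fun s _ => semiH2_nonneg _
  have hD := hV'.sub hV
  have hDm := hD.memLp
  rw [← norm_eq_sqrt hDm.coeFn_toLp]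
  refine norm_le_of_inner_le ?_ hK0
  -- Second derivatives of `u₁ s` are controlled only in norm for almost every `s`, with no Bochner
  -- integrability assumed. Testing against a dense space avoids integrating them in time; both
  -- sides are continuous in `f`.
  refine testSpace_dense.induction (P := fun f => inner ℝ hDm.toLp f ≤ K * ‖f‖) ?_
    (isClosed_le (by fun_prop) (by fun_prop)) _
  rintro f ⟨φ, ψ, hφ, hψ, hf⟩
  have hχ : MemLp (fun x => iteratedDeriv 2 φ x + iteratedDeriv 2 ψ x) 2 P.vol :=
    hφ.iteratedDeriv_two.memLp.add hψ.iteratedDeriv_two.memLp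
  set χ : P.L2 := hχ.toLp with hχd
  have hχe : χ =ᵐ[P.vol] _ := hχ.coeFn_toLp
  have hub' : (u b - u a : P.L2) =ᵐ[P.vol] fun x => V' x - V x := by
    filter_upwards [Lp.coeFn_sub (u b) (u a), hua, hub] with x e1 e2 e3
    rw [e1, Pi.sub_apply, e2, e3]
  have h1 : inner ℝ hDm.toLp f = inner ℝ χ (u b) - inner ℝ χ (u a) := by
    rw [← inner_sub_right, inner_eq_integral hDm.coeFn_toLp hf,
      real_inner_comm, inner_eq_integral hub' hχe]
    exact (integral_mul_iteratedDeriv_test hD.hasGrad.memLp_self hDm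
      (hD.isWeakDeriv_two_left EventuallyEq.rfl) (hD.isWeakDeriv_two_right EventuallyEq.rfl)
      hφ hψ).symm
  rw [h1, (h₁.isPrimitiveOn_inner hT χ).sub_eq ha' hb', hK, mul_comm,
    ← intervalIntegral.integral_const_mul]
  have hae : ∀ᵐ s ∂volume.restrict (Ioc a b), P.MemBroken 2 (u₁ s) :=
    ae_restrict_of_ae_restrict_of_subset (Ioc_subset_Ioc ha hb) hH.1
  rw [intervalIntegral.integral_of_le hab, intervalIntegral.integral_of_le hab]
  refine integral_mono_ae ((h₁.isPrimitiveOn_inner hT χ).integrable_sub ha' hb').1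
    (hi.const_mul _).1 ?_
  -- At a fixed time the derivatives are moved back onto `u₁ s`, and Cauchy–Schwarz yields the
  -- seminorm.
  filter_upwards [hae] with s hs
  obtain ⟨W, hW, hl, hr, hsemi⟩ := hs.exists_second
  rw [hsemi, ← norm_eq_sqrt hW.coeFn_toLp, real_inner_comm,
    inner_eq_integral EventuallyEq.rfl hχe,
    integral_mul_iteratedDeriv_test (Lp.memLp (u₁ s)) hW hl hr hφ hψ,
    ← inner_eq_integral hW.coeFn_toLp hf, mul_comm]
  exact real_inner_le_norm _ _

end Data

namespace Data

variable {P : Data}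

/-! ### The weighted product -/

theorem cp_pos : 0 < P.cp := div_pos P.lam_pos P.Dp_pos

theorem cm_pos : 0 < P.cm := div_pos (sub_pos.2 P.lam_lt_one) P.Dm_pos

theorem sqrt_c_le (x : ℝ) : Real.sqrt (P.c x) ≤ max (Real.sqrt P.cp) (Real.sqrt P.cm) := by
  unfold c
  split_ifs
  exacts [le_max_left _ _, le_max_right _ _]

theorem le_sqrt_c (x : ℝ) : min (Real.sqrt P.cp) (Real.sqrt P.cm) ≤ Real.sqrt (P.c x) := by
  unfold c
  split_ifs
  exacts [min_le_left _ _, min_le_right _ _]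

theorem c_nonneg (x : ℝ) : 0 ≤ P.c x := by
  unfold c
  split_ifs
  exacts [P.cp_pos.le, P.cm_pos.le]

theorem min_sqrt_pos : 0 < min (Real.sqrt P.cp) (Real.sqrt P.cm) :=
  lt_min (Real.sqrt_pos.2 P.cp_pos) (Real.sqrt_pos.2 P.cm_pos)

theorem measurable_c : Measurable P.c :=
  Measurable.ite measurableSet_Ioi measurable_const measurable_const

theorem one_le_alpha3 : 1 ≤ P.alpha3 := (one_le_div P.min_sqrt_pos).2 min_le_max

theorem memLp_sqrt_c_mul {f : ℝ → ℝ} (hf : MemLp f 2 P.vol) :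
    MemLp (fun x => Real.sqrt (P.c x) * f x) 2 P.vol := by
  refine hf.of_le_mul (c := max (Real.sqrt P.cp) (Real.sqrt P.cm))
    (P.measurable_c.sqrt.aestronglyMeasurable.mul hf.1) (ae_of_all _ fun x => ?_)
  rw [norm_mul, Real.norm_of_nonneg (Real.sqrt_nonneg _)]
  exact mul_le_mul_of_nonneg_right (P.sqrt_c_le x) (norm_nonneg _)

/-- Splitting `c = √c √c` makes the weighted product an ordinary inner product. -/
theorem massForm_eq_inner {f g : ℝ → ℝ} (hf : MemLp f 2 P.vol) (hg : MemLp g 2 P.vol) :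
    P.massForm f g = inner ℝ (memLp_sqrt_c_mul hf).toLp (memLp_sqrt_c_mul hg).toLp := by
  rw [inner_eq_integral (MemLp.coeFn_toLp _) (MemLp.coeFn_toLp _), massForm]
  congr 1
  ext x
  have := Real.mul_self_sqrt (P.c_nonneg x)
  calc P.c x * f x * g x = (Real.sqrt (P.c x) * Real.sqrt (P.c x)) * f x * g x := by rw [this]
    _ = _ := by ring

/-- The weighted norm `(c f, f)^{1/2}`. -/
def wnorm (P : Data) (f : ℝ → ℝ) : ℝ := P.l2norm fun x => Real.sqrt (P.c x) * f x

theorem wnorm_le {f : ℝ → ℝ} (hf : MemLp f 2 P.vol) :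
    P.wnorm f ≤ max (Real.sqrt P.cp) (Real.sqrt P.cm) * P.l2norm f := by
  rw [wnorm, l2norm_eq_norm (memLp_sqrt_c_mul hf).coeFn_toLp, l2norm_eq_norm hf.coeFn_toLp]
  refine Lp.norm_le_mul_norm_of_ae_le_mul ?_
  filter_upwards [(memLp_sqrt_c_mul hf).coeFn_toLp, hf.coeFn_toLp] with x h1 h2
  rw [h1, h2, norm_mul, Real.norm_of_nonneg (Real.sqrt_nonneg _)]
  exact mul_le_mul_of_nonneg_right (P.sqrt_c_le x) (norm_nonneg _)

/-- The constants of this bound and of `wnorm_le` multiply to `α₃`. -/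
theorem le_wnorm {f : ℝ → ℝ} (hf : MemLp f 2 P.vol) :
    P.l2norm f ≤ (min (Real.sqrt P.cp) (Real.sqrt P.cm))⁻¹ * P.wnorm f := by
  rw [wnorm, l2norm_eq_norm (memLp_sqrt_c_mul hf).coeFn_toLp, l2norm_eq_norm hf.coeFn_toLp]
  refine Lp.norm_le_mul_norm_of_ae_le_mul ?_
  filter_upwards [(memLp_sqrt_c_mul hf).coeFn_toLp, hf.coeFn_toLp] with x h1 h2
  rw [h1, h2, norm_mul, Real.norm_of_nonneg (Real.sqrt_nonneg _), ← div_eq_inv_mul,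
    le_div_iff₀ P.min_sqrt_pos, mul_comm]
  exact mul_le_mul_of_nonneg_right (P.le_sqrt_c x) (norm_nonneg _)

theorem integrable_massForm {f v : ℝ → ℝ} (hf : MemLp f 2 P.vol) (hv : MemLp v 2 P.vol) :
    Integrable (fun x => P.c x * f x * v x) P.vol := by
  refine ((memLp_sqrt_c_mul hf).integrable_mul (memLp_sqrt_c_mul hv)).congr (ae_of_all _ fun x => ?_)
  have := Real.mul_self_sqrt (P.c_nonneg x)
  simp only [Pi.mul_apply]
  calc _ = (Real.sqrt (P.c x) * Real.sqrt (P.c x)) * f x * v x := by ring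
    _ = _ := by rw [this]

theorem massForm_add {f g v : ℝ → ℝ} (hf : MemLp f 2 P.vol) (hg : MemLp g 2 P.vol)
    (hv : MemLp v 2 P.vol) :
    P.massForm (fun x => f x + g x) v = P.massForm f v + P.massForm g v := by
  rw [massForm, massForm, massForm,
    ← integral_add (integrable_massForm hf hv) (integrable_massForm hg hv)]
  congr 1; ext x; ring

theorem massForm_sub {f g v : ℝ → ℝ} (hf : MemLp f 2 P.vol) (hg : MemLp g 2 P.vol)
    (hv : MemLp v 2 P.vol) :
    P.massForm (fun x => f x - g x) v = P.massForm f v - P.massForm g v := by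
  rw [massForm, massForm, massForm,
    ← integral_sub (integrable_massForm hf hv) (integrable_massForm hg hv)]
  congr 1; ext x; ring

theorem massForm_const_mul (r : ℝ) (f v : ℝ → ℝ) :
    P.massForm (fun x => r * f x) v = r * P.massForm f v := by
  rw [massForm, massForm, ← integral_const_mul]
  congr 1; ext x; ring

/-- The energy estimate for one step of the Crank-Nicolson scheme. -/
theorem wnorm_le_add_of_massForm_le {a b r : ℝ → ℝ} (ha : MemLp a 2 P.vol) (hb : MemLp b 2 P.vol)
    (hr : MemLp r 2 P.vol)
    (h : P.massForm (fun x => a x - b x) (fun x => a x + b x) ≤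
      P.massForm r fun x => a x + b x) :
    P.wnorm a ≤ P.wnorm b + P.wnorm r := by
  set α := (memLp_sqrt_c_mul ha).toLp with hα
  set β := (memLp_sqrt_c_mul hb).toLp with hβ
  set γ := (memLp_sqrt_c_mul hr).toLp with hγ
  have e1 : (memLp_sqrt_c_mul (ha.add hb)).toLp = α + β := by
    rw [hα, hβ, ← MemLp.toLp_add]
    congr 1
    ext x
    simp [mul_add]
  have e2 : (memLp_sqrt_c_mul (ha.sub hb)).toLp = α - β := by
    rw [hα, hβ, ← MemLp.toLp_sub]
    congr 1
    ext x
    simp [mul_sub]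
  have h1 := massForm_eq_inner (ha.sub hb) (ha.add hb)
  have h2 := massForm_eq_inner hr (ha.add hb)
  rw [e1, e2] at h1
  rw [e1] at h2
  have h3 : inner ℝ (α - β) (α + β) ≤ inner ℝ γ (α + β) := by
    rw [← h1, ← h2]
    exact h
  have h4 : inner ℝ (α - β) (α + β) = ‖α‖ ^ 2 - ‖β‖ ^ 2 := by
    rw [inner_add_right, inner_sub_left, inner_sub_left, real_inner_self_eq_norm_sq,
      real_inner_self_eq_norm_sq, real_inner_comm]
    ring
  have h5 : inner ℝ γ (α + β) ≤ ‖γ‖ * (‖α‖ + ‖β‖) :=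
    (real_inner_le_norm _ _).trans (mul_le_mul_of_nonneg_left (norm_add_le _ _) (norm_nonneg _))
  rw [wnorm, wnorm, wnorm, l2norm_eq_norm (memLp_sqrt_c_mul ha).coeFn_toLp,
    l2norm_eq_norm (memLp_sqrt_c_mul hb).coeFn_toLp, l2norm_eq_norm (memLp_sqrt_c_mul hr).coeFn_toLp]
  -- Arguing by contradiction avoids dividing `‖α‖² - ‖β‖² ≤ ‖γ‖ (‖α‖ + ‖β‖)` by a sum that may be
  -- zero.
  by_contra! hcon
  change ‖β‖ + ‖γ‖ < ‖α‖ at hcon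
  nlinarith [norm_nonneg α, norm_nonneg β, norm_nonneg γ]

/-! ### The bilinear form -/

section stiff

variable {V d W e v b : ℝ → ℝ}

theorem HasGrad.stiffForm_add (hV : P.HasGrad V d) (hW : P.HasGrad W e) (hv : P.HasGrad v b) :
    P.stiffForm (fun x => V x + W x) v = P.stiffForm V v + P.stiffForm W v := by
  rw [(hV.add hW).stiffForm_eq hv EventuallyEq.rfl EventuallyEq.rfl,
    hV.stiffForm_eq hv EventuallyEq.rfl EventuallyEq.rfl,
    hW.stiffForm_eq hv EventuallyEq.rfl EventuallyEq.rfl,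
    ← integral_add (hV.integrable_mul hv) (hW.integrable_mul hv)]
  congr 1; ext x; ring

theorem HasGrad.stiffForm_sub (hV : P.HasGrad V d) (hW : P.HasGrad W e) (hv : P.HasGrad v b) :
    P.stiffForm (fun x => V x - W x) v = P.stiffForm V v - P.stiffForm W v := by
  rw [(hV.sub hW).stiffForm_eq hv EventuallyEq.rfl EventuallyEq.rfl,
    hV.stiffForm_eq hv EventuallyEq.rfl EventuallyEq.rfl,
    hW.stiffForm_eq hv EventuallyEq.rfl EventuallyEq.rfl,
    ← integral_sub (hV.integrable_mul hv) (hW.integrable_mul hv)]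
  congr 1; ext x; ring

theorem HasGrad.stiffForm_const_mul (r : ℝ) (hV : P.HasGrad V d) (hv : P.HasGrad v b) :
    P.stiffForm (fun x => r * V x) v = r * P.stiffForm V v := by
  rw [(hV.const_mul r).stiffForm_eq hv EventuallyEq.rfl EventuallyEq.rfl,
    hV.stiffForm_eq hv EventuallyEq.rfl EventuallyEq.rfl, ← integral_const_mul]
  congr 1; ext x; ring

theorem HasGrad.stiffForm_self_nonneg (hv : P.HasGrad v b) : 0 ≤ P.stiffForm v v := by
  rw [hv.stiffForm_eq hv EventuallyEq.rfl EventuallyEq.rfl]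
  refine integral_nonneg fun x => ?_
  rw [Pi.zero_apply, mul_assoc]
  exact mul_nonneg (P.kap_pos x).le (mul_self_nonneg _)

theorem HasGrad.stiffForm_congr {u : ℝ → ℝ} (hV : P.HasGrad V d) (hv : P.HasGrad v b)
    (hu : u =ᵐ[P.vol] V) : P.stiffForm u v = P.stiffForm V v := by
  rw [hV.stiffForm_eq hv hu EventuallyEq.rfl,
    hV.stiffForm_eq hv EventuallyEq.rfl EventuallyEq.rfl]

/-- The nodal interpolant is the Ritz projection. -/
theorem IsElementwise.stiffForm_eq_of_nodes {N : ℕ} (hN : 1 ≤ N) (hv : P.IsElementwise N v b)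
    (hV : P.HasGrad V d) (hW : P.HasGrad W e)
    (h0 : ∀ j : ℕ, j ≤ N → V (P.node N j) = W (P.node N j)) :
    P.stiffForm V v = P.stiffForm W v := by
  rw [← sub_eq_zero, ← hV.stiffForm_sub hW hv.hasGrad,
    (hV.sub hW).stiffForm_eq hv.hasGrad EventuallyEq.rfl EventuallyEq.rfl]
  exact hv.integral_eq_zero hN (hV.sub hW) fun j hj => by rw [h0 j hj, sub_self]

/-- As `V` vanishes at both ends, `q / κ` has mean zero and the flux is bounded by its variation
over the whole domain. The crude constant is harmless: the bound serves only a limit in time. -/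
theorem HasFlux.abs_stiffForm_le {q G : ℝ → ℝ} (hV : P.HasFlux V q G) (hv : P.HasGrad v b) :
    |P.stiffForm V v| ≤ ((P.kp + P.km) * Real.sqrt (P.L - -P.L) * ∫ x, |b x| ∂P.vol) *
      Real.sqrt (∫ x, G x ^ 2 ∂P.vol) := by
  have hG := P.intervalIntegrable_of_vol (hV.memLp.integrable (by norm_num))
  have hG2 := P.intervalIntegrable_of_vol hV.memLp.integrable_sq
  have hk : 0 ≤ P.kp + P.km := (add_pos P.kp_pos P.km_pos).le
  have h1 : ∀ x ∈ Icc (-P.L) P.L,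
      |q x| ≤ (P.kp + P.km) * (Real.sqrt (P.L - -P.L) * Real.sqrt (∫ x, G x ^ 2 ∂P.vol)) := by
    intro x hx
    have h2 := abs_flux_sub_le (c := 0) P.neg_L_lt hV.prim (hV.left.trans hV.right.symm) hV.flux hG
      (fun x _ => by rw [sub_zero]) hx
    rw [sub_zero] at h2
    refine h2.trans ?_
    have h3 : ∫ s in (-P.L)..P.L, P.kap s * |G s| ≤
        (P.kp + P.km) * ∫ s in (-P.L)..P.L, |G s| := by
      rw [← intervalIntegral.integral_const_mul]
      exact intervalIntegral.integral_mono_on P.neg_L_lt.le (intervalIntegrable_kap_mul hG.abs)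
        (hG.abs.const_mul _) fun s _ => mul_le_mul_of_nonneg_right (P.kap_le_add s) (abs_nonneg _)
    refine h3.trans (mul_le_mul_of_nonneg_left ?_ hk)
    rw [← Real.sqrt_mul (sub_nonneg.2 P.neg_L_lt.le), integral_vol]
    exact Real.le_sqrt_of_sq_le (sq_integral_abs_le P.neg_L_lt hG hG2)
  have hbi : Integrable b P.vol := hv.memLp.integrable (by norm_num)
  rw [hV.hasGrad.stiffForm_eq hv EventuallyEq.rfl EventuallyEq.rfl]
  refine (abs_integral_le_integral_abs).trans ?_
  have h4 := integral_mono_ae (hV.hasGrad.integrable_mul hv).abs (hbi.abs.const_mul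
    ((P.kp + P.km) * (Real.sqrt (P.L - -P.L) * Real.sqrt (∫ x, G x ^ 2 ∂P.vol)))) (by
      have hm : ∀ᵐ x ∂P.vol, x ∈ Ioo (-P.L) P.L := ae_restrict_mem measurableSet_Ioo
      filter_upwards [hm] with x hx
      rw [mul_div_cancel₀ _ (P.kap_pos x).ne', abs_mul]
      exact mul_le_mul_of_nonneg_right (h1 x (Ioo_subset_Icc_self hx)) (abs_nonneg _))
  rw [integral_const_mul] at h4
  refine h4.trans (le_of_eq ?_)
  ring

theorem IsElementwise.sub {N : ℕ} (hV : P.IsElementwise N V d) (hW : P.IsElementwise N W e) :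
    P.IsElementwise N (fun x => V x - W x) fun x => d x - e x where
  hasGrad := hV.hasGrad.sub hW.hasGrad
  const j hj := by
    obtain ⟨r, hr⟩ := hV.const j hj
    obtain ⟨t, ht⟩ := hW.const j hj
    exact ⟨r - t, fun x hx => by rw [mul_sub, hr x hx, ht x hx]⟩

end stiff

/-- The interpolation error in the norm of `L²(Ω)`. -/
theorem HasFlux.l2norm_sub_le {N : ℕ} (hN : 1 ≤ N) {V q G W e : ℝ → ℝ} (hV : P.HasFlux V q G)
    (hW : P.IsElementwise N W e) (h0 : ∀ j : ℕ, j ≤ N → V (P.node N j) = W (P.node N j)) :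
    P.l2norm (fun x => V x - W x) ≤ P.rho * P.h N ^ 2 * Real.sqrt (∫ x, G x ^ 2 ∂P.vol) := by
  rw [l2norm_eq_sqrt (hV.hasGrad.sub hW.hasGrad).memLp_self]
  refine (Real.sqrt_le_sqrt (hV.integral_sq_sub_le hN hW h0)).trans (le_of_eq ?_)
  rw [Real.sqrt_mul (sq_nonneg _), Real.sqrt_sq (mul_nonneg P.rho_nonneg (sq_nonneg _))]

/-! ### The weak equation at the initial time -/

namespace IsWeakSolution

variable {T : ℝ} {u u₁ u₂ u₃ : ℝ → P.L2}

theorem intervalIntegrable_semiH2 (hs : P.IsWeakSolution T u u₁ u₂ u₃) {a b : ℝ}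
    (ha : a ∈ Icc 0 T) (hb : b ∈ Icc 0 T) :
    IntervalIntegrable (fun t => P.semiH2 (u₁ t)) volume a b :=
  hs.mem_one.2.mono_set (by
    rw [uIcc_of_le (ha.1.trans ha.2)]
    exact uIcc_subset_Icc ha hb)

/-- The equation is given for `t > 0`, but the first trapezoidal step needs it at `0`. The mass term
is continuous because `u₁` is absolutely continuous in `L²`, and the stiffness term changes by at
most a multiple of `∫₀ᵗ |∂ₜu|`, in the broken seminorm. -/
theorem weak_eq_initial (hs : P.IsWeakSolution T u u₁ u₂ u₃) (hT : 0 < T) {v b : ℝ → ℝ}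
    (hv : P.HasGrad v b) : P.massForm (u₁ 0) v + P.stiffForm (u 0) v = 0 := by
  set C := (P.kp + P.km) * Real.sqrt (P.L - -P.L) * ∫ x, |b x| ∂P.vol with hC
  have hC0 : 0 ≤ C := mul_nonneg (mul_nonneg (add_pos P.kp_pos P.km_pos).le (Real.sqrt_nonneg _))
    (integral_nonneg fun x => abs_nonneg _)
  have hcv : MemLp (fun x => P.c x * v x) 2 P.vol := by
    refine (memLp_sqrt_c_mul (memLp_sqrt_c_mul hv.memLp_self)).ae_eq (ae_of_all _ fun x => ?_)
    simp only
    rw [← mul_assoc, Real.mul_self_sqrt (P.c_nonneg x)]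
  set z : P.L2 := hcv.toLp with hz
  have hm : ∀ f : P.L2, P.massForm f v = inner ℝ z f := fun f => by
    rw [inner_eq_integral hcv.coeFn_toLp EventuallyEq.rfl, massForm]
    congr 1; ext x; ring
  have h0T : (0 : ℝ) ∈ Icc 0 T := ⟨le_rfl, hT.le⟩
  obtain ⟨V₀, q₀, G₀, hu₀, hV₀⟩ := (hs.mem 0 h0T).exists_hasFlux
  have hst : ∀ t ∈ Ioc 0 T, |P.stiffForm (u t) v - P.stiffForm (u 0) v| ≤
      C * ∫ s in (0 : ℝ)..t, P.semiH2 (u₁ s) := by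
    intro t ht
    obtain ⟨V, q, G, hu, hV⟩ := (hs.mem t (Ioc_subset_Icc_self ht)).exists_hasFlux
    rw [hV.hasGrad.stiffForm_congr hv hu, hV₀.hasGrad.stiffForm_congr hv hu₀,
      ← hV.hasGrad.stiffForm_sub hV₀.hasGrad hv]
    exact ((hV.sub hV₀).abs_stiffForm_le hv).trans (mul_le_mul_of_nonneg_left
      (sqrt_integral_sq_sub_le hs.deriv_one hs.mem_one le_rfl ht.1.le ht.2 hV₀ hV hu₀ hu) hC0)
  set F : ℝ → ℝ := fun t => |inner ℝ z (u₁ t) - inner ℝ z (u₁ 0)| +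
    C * ∫ s in (0 : ℝ)..t, P.semiH2 (u₁ s) with hF
  have hFc : ContinuousOn F (Icc 0 T) := by
    have c1 := (hs.deriv_two.isPrimitiveOn_inner hT.le z).continuousOn hT.le
    have c2 : IsPrimitiveOn 0 T (fun t => ∫ s in (0 : ℝ)..t, P.semiH2 (u₁ s))
        fun s => P.semiH2 (u₁ s) := ⟨hs.mem_one.2, fun x _ => by simp⟩
    exact ((c1.sub continuousOn_const).abs).add (continuousOn_const.mul (c2.continuousOn hT.le))
  have hlim : Tendsto F (𝓝[>] 0) (𝓝 0) := by
    have h1 := ((hFc 0 h0T).mono_of_mem_nhdsWithin (Icc_mem_nhdsGT hT)).tendsto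
    have h2 : F 0 = 0 := by simp [hF]
    rwa [h2] at h1
  have hle : |P.massForm (u₁ 0) v + P.stiffForm (u 0) v| ≤ 0 := by
    refine ge_of_tendsto hlim ?_
    filter_upwards [Ioc_mem_nhdsGT hT] with t ht
    have h1 := hs.weak_eq t ht v hv.memBrokenZero
    have h2 := hst t ht
    rw [hm] at h1 ⊢
    have h3 : inner ℝ z (u₁ 0) + P.stiffForm (u 0) v =
        -((inner ℝ z (u₁ t) - inner ℝ z (u₁ 0)) + (P.stiffForm (u t) v - P.stiffForm (u 0) v)) := by
      linarith
    rw [h3, abs_neg]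
    exact (abs_add_le _ _).trans (by simpa only [hF] using add_le_add_right h2 _)
  exact abs_nonpos_iff.1 hle

theorem weak_eq_closed (hs : P.IsWeakSolution T u u₁ u₂ u₃) (hT : 0 < T) {v b : ℝ → ℝ}
    (hv : P.HasGrad v b) {t : ℝ} (ht : t ∈ Icc 0 T) :
    P.massForm (u₁ t) v + P.stiffForm (u t) v = 0 := by
  rcases ht.1.eq_or_lt with h | h
  · rw [← h]
    exact hs.weak_eq_initial hT hv
  · exact hs.weak_eq t ⟨h, ht.2⟩ v hv.memBrokenZero

/-! ### One time step -/

/-- Interpolants may replace `u` in the stiffness form by the Ritz property, so averaging the weak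
equation at the two times and subtracting the scheme leaves only the mass residual `r`. -/
theorem wnorm_step_le (hs : P.IsWeakSolution T u u₁ u₂ u₃) (hT : 0 < T) {N : ℕ} (hN : 1 ≤ N)
    {a b : ℝ} (ha : 0 ≤ a) (hab : a < b) (hb : b ≤ T) {V V' q q' G G' I I' U U' : ℝ → ℝ}
    (hV : P.HasFlux V q G) (hV' : P.HasFlux V' q' G') (hu : u a =ᵐ[P.vol] V)
    (hu' : u b =ᵐ[P.vol] V') (hI : I ∈ P.Sh N) (hI' : I' ∈ P.Sh N)
    (hn : ∀ j : ℕ, j ≤ N → I (P.node N j) = V (P.node N j))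
    (hn' : ∀ j : ℕ, j ≤ N → I' (P.node N j) = V' (P.node N j)) (hU : U ∈ P.Sh N)
    (hU' : U' ∈ P.Sh N)
    (hCN : ∀ v ∈ P.Sh N, P.massForm (fun x => (U' x - U x) / (b - a)) v +
      P.stiffForm (fun x => (U' x + U x) / 2) v = 0) :
    P.wnorm (fun x => I' x - U' x) ≤ P.wnorm (fun x => I x - U x) +
      max (Real.sqrt P.cp) (Real.sqrt P.cm) *
        (P.rho * P.h N ^ 2 * (∫ s in a..b, P.semiH2 (u₁ s)) +
          (b - a) ^ 2 / 8 * ∫ s in a..b, ‖u₃ s‖) := by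
  have hba : 0 < b - a := sub_pos.2 hab
  have ha' : a ∈ Icc 0 T := ⟨ha, hab.le.trans hb⟩
  have hb' : b ∈ Icc 0 T := ⟨ha.trans hab.le, hb⟩
  obtain ⟨i, hi⟩ := exists_isElementwise hN hI
  obtain ⟨i', hi'⟩ := exists_isElementwise hN hI'
  obtain ⟨e, he⟩ := exists_isElementwise hN hU
  obtain ⟨e', he'⟩ := exists_isElementwise hN hU'
  have mI := hi.hasGrad.memLp_self
  have mI' := hi'.hasGrad.memLp_self
  have mU := he.hasGrad.memLp_self
  have mU' := he'.hasGrad.memLp_self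
  have m1 := Lp.memLp (u₁ a)
  have m1' := Lp.memLp (u₁ b)
  set r : ℝ → ℝ := fun x => (I' x - I x) - (b - a) / 2 * (u₁ b x + u₁ a x) with hr
  have mr : MemLp r 2 P.vol := (mI'.sub mI).sub ((m1'.add m1).const_mul _)
  -- the energy inequality
  have hstep : P.wnorm (fun x => I' x - U' x) ≤ P.wnorm (fun x => I x - U x) + P.wnorm r := by
    refine wnorm_le_add_of_massForm_le (mI'.sub mU') (mI.sub mU) mr ?_
    -- The test function is the sum of the new and old discrete errors, so the averaged stiffness
    -- term is half of `𝓛(v, v)`.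
    set v : ℝ → ℝ := fun x => (I' x - U' x) + (I x - U x) with hv
    have hvS : v ∈ P.Sh N := Submodule.add_mem _ (Submodule.sub_mem _ hI' hU')
      (Submodule.sub_mem _ hI hU)
    obtain ⟨w, hw⟩ := exists_isElementwise hN hvS
    have mv := hw.hasGrad.memLp_self
    have k1 := hCN v hvS
    have k2 := hs.weak_eq_closed hT hw.hasGrad ha'
    have k3 := hs.weak_eq_closed hT hw.hasGrad hb'
    rw [hV.hasGrad.stiffForm_congr hw.hasGrad hu,
      ← hw.stiffForm_eq_of_nodes hN hi.hasGrad hV.hasGrad hn] at k2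
    rw [hV'.hasGrad.stiffForm_congr hw.hasGrad hu',
      ← hw.stiffForm_eq_of_nodes hN hi'.hasGrad hV'.hasGrad hn'] at k3
    have k4 : 0 ≤ (P.stiffForm I' v - P.stiffForm U' v) + (P.stiffForm I v - P.stiffForm U v) := by
      have := hw.hasGrad.stiffForm_self_nonneg
      rwa [← hi'.hasGrad.stiffForm_sub he'.hasGrad hw.hasGrad,
        ← hi.hasGrad.stiffForm_sub he.hasGrad hw.hasGrad,
        ← (hi'.hasGrad.sub he'.hasGrad).stiffForm_add (hi.hasGrad.sub he.hasGrad) hw.hasGrad]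
    have k5 : P.massForm (fun x => (U' x - U x) / (b - a)) v =
        (P.massForm U' v - P.massForm U v) / (b - a) := by
      simp_rw [div_eq_inv_mul]
      rw [massForm_const_mul, massForm_sub mU' mU mv]
    have k6 : P.stiffForm (fun x => (U' x + U x) / 2) v =
        (P.stiffForm U' v + P.stiffForm U v) / 2 := by
      simp_rw [div_eq_inv_mul]
      rw [(he'.hasGrad.add he.hasGrad).stiffForm_const_mul _ hw.hasGrad,
        he'.hasGrad.stiffForm_add he.hasGrad hw.hasGrad]
    rw [k5, k6] at k1
    have k7 : P.massForm U' v - P.massForm U v =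
        -((b - a) * ((P.stiffForm U' v + P.stiffForm U v) / 2)) := by
      field_simp at k1
      linarith
    have k8 := massForm_sub (f := fun x => I' x - U' x) (g := fun x => I x - U x)
      (mI'.sub mU') (mI.sub mU) mv
    have k9 := massForm_sub (f := fun x => I' x - I x)
      (g := fun x => (b - a) / 2 * (u₁ b x + u₁ a x)) (mI'.sub mI) ((m1'.add m1).const_mul _) mv
    rw [massForm_sub mI' mU' mv, massForm_sub mI mU mv] at k8
    rw [massForm_sub mI' mI mv, massForm_const_mul, massForm_add m1' m1 mv] at k9
    rw [k8, hr, k9]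
    nlinarith [mul_nonneg hba.le k4]
  -- the consistency error
  have hE : P.l2norm (fun x => (V' x - V x) - (I' x - I x)) ≤
      P.rho * P.h N ^ 2 * ∫ s in a..b, P.semiH2 (u₁ s) :=
    ((hV'.sub hV).l2norm_sub_le hN (hi'.sub hi) (fun j hj => by rw [hn j hj, hn' j hj])).trans
      (mul_le_mul_of_nonneg_left
        (sqrt_integral_sq_sub_le hs.deriv_one hs.mem_one ha hab.le hb hV hV' hu hu')
        (mul_nonneg P.rho_nonneg (sq_nonneg _)))
  have mE : MemLp (fun x => (V' x - V x) - (I' x - I x)) 2 P.vol :=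
    ((hV'.sub hV).hasGrad.sub (hi'.sub hi).hasGrad).memLp_self
  set τ : P.L2 := u b - u a - ((b - a) / 2) • (u₁ a + u₁ b) with hτ
  have hτn := norm_trapezoid_le hs.deriv_one hs.deriv_two hs.deriv_three ha hab.le hb
  have hτe : τ =ᵐ[P.vol] fun x => (V' x - V x) - (b - a) / 2 * (u₁ b x + u₁ a x) := by
    filter_upwards [Lp.coeFn_sub (u b - u a) (((b - a) / 2) • (u₁ a + u₁ b)),
      Lp.coeFn_sub (u b) (u a), Lp.coeFn_smul ((b - a) / 2) (u₁ a + u₁ b),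
      Lp.coeFn_add (u₁ a) (u₁ b), hu, hu'] with x h1 h2 h3 h4 h5 h6
    rw [h1, Pi.sub_apply, h2, h3, Pi.sub_apply, Pi.smul_apply, h4, Pi.add_apply, h5, h6, smul_eq_mul,
      add_comm (u₁ a x)]
  have mτ : MemLp (fun x => (V' x - V x) - (b - a) / 2 * (u₁ b x + u₁ a x)) 2 P.vol :=
    (Lp.memLp τ).ae_eq hτe
  have hrn : P.l2norm r ≤ P.rho * P.h N ^ 2 * (∫ s in a..b, P.semiH2 (u₁ s)) +
      (b - a) ^ 2 / 8 * ∫ s in a..b, ‖u₃ s‖ := by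
    have hneg : P.l2norm (fun x => -((V' x - V x) - (I' x - I x))) =
        P.l2norm (fun x => (V' x - V x) - (I' x - I x)) := by
      rw [l2norm, l2norm]
      exact congrArg ENNReal.toReal (eLpNorm_neg _ _ _)
    -- The residual is minus the interpolation error of the increment plus the trapezoidal error.
    -- Interpolating the increment rather than the endpoints lets these errors sum to an integral of
    -- `∂ₜu`.
    have e1 : r = fun x => -((V' x - V x) - (I' x - I x)) +
        ((V' x - V x) - (b - a) / 2 * (u₁ b x + u₁ a x)) := by
      ext x
      simp only [hr]
      ring
    rw [e1]
    refine (l2norm_add_le mE.neg mτ).trans (add_le_add ?_ ?_)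
    · exact hneg.le.trans hE
    · rw [l2norm_eq_norm hτe]
      exact hτn
  refine hstep.trans (add_le_add le_rfl ((wnorm_le mr).trans ?_))
  exact mul_le_mul_of_nonneg_left hrn (le_max_of_le_left (Real.sqrt_nonneg _))

end IsWeakSolution

/-! ### Summation over the time steps and the final constants. -/

theorem le_maxUpTo {n k : ℕ} (f : ℕ → ℝ) (hk : k ≤ n) : f k ≤ maxUpTo n f :=
  Finset.le_sup' f (Finset.mem_range.2 (Nat.lt_succ_of_le hk))

/-- The exponent 1 is always admissible, since `max M 2 - 1 ≥ 1` even for `M = 1`. -/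
theorem alpha3_le_alpha4 (M : ℕ) : P.alpha3 ≤ P.alpha4 M := by
  have h := le_maxUpTo (n := max M 2 - 1) (k := 1) (fun l => P.alpha3 ^ l) (by omega)
  simpa [alpha4] using h

/-- The error estimate, with the optimal power of `α₃` in all terms. -/
theorem maxUpTo_error_le {T : ℝ} {N M : ℕ} (hT : 0 < T) (hN : 1 ≤ N) (hM : 1 ≤ M)
    {u u₁ u₂ u₃ : ℝ → P.L2} {uh : ℕ → ℝ → ℝ} (hs : P.IsWeakSolution T u u₁ u₂ u₃)
    (hCN : P.IsCrankNicolson N M (T / M) uh) {A : ℝ} (hA : P.alpha3 ≤ A) :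
    maxUpTo M (fun k : ℕ => P.l2norm (fun x => u (k * (T / M)) x - uh k x)) ≤
      P.errorBound 2 A T N M u u₁ u₂ u₃
        (P.l2norm (fun x => u ((0 : ℕ) * (T / M)) x - uh 0 x)) := by
  have hM' : (0 : ℝ) < M := by exact_mod_cast hM
  set dt := T / M with hdt
  have hdt0 : 0 < dt := div_pos hT hM'
  have htk : ∀ k : ℕ, k ≤ M → (k : ℝ) * dt ∈ Icc 0 T := fun k hk => by
    refine ⟨by positivity, ?_⟩
    have h1 : (k : ℝ) ≤ M := by exact_mod_cast hk
    calc (k : ℝ) * dt ≤ M * dt := mul_le_mul_of_nonneg_right h1 hdt0.le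
      _ = T := by rw [hdt]; field_simp
  have hrep : ∀ k : ℕ, ∃ V q G I : ℝ → ℝ, k ≤ M → u (k * dt) =ᵐ[P.vol] V ∧ P.HasFlux V q G ∧
      I ∈ P.Sh N ∧ ∀ j : ℕ, j ≤ N → I (P.node N j) = V (P.node N j) := by
    intro k
    by_cases hk : k ≤ M
    · obtain ⟨V, q, G, hu, hV⟩ := (hs.mem _ (htk k hk)).exists_hasFlux
      obtain ⟨I, hI, hn⟩ := exists_interpolant hN hV.left hV.right
      exact ⟨V, q, G, I, fun _ => ⟨hu, hV, hI, hn⟩⟩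
    -- Zero functions past the last step make the choice total.
    · exact ⟨0, 0, 0, 0, fun h => absurd h hk⟩
  choose V q G I hrep using hrep
  set cM := max (Real.sqrt P.cp) (Real.sqrt P.cm) with hcM
  set cm := min (Real.sqrt P.cp) (Real.sqrt P.cm) with hcm
  have hcm0 : 0 < cm := P.min_sqrt_pos
  have hcM0 : 0 ≤ cM := le_max_of_le_left (Real.sqrt_nonneg _)
  have hρ : 0 ≤ P.rho * P.h N ^ 2 := mul_nonneg P.rho_nonneg (sq_nonneg _)
  -- stability of the scheme
  have hind : ∀ k : ℕ, k ≤ M → P.wnorm (fun x => I k x - uh k x) ≤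
      P.wnorm (fun x => I 0 x - uh 0 x) + cM *
        (P.rho * P.h N ^ 2 * (∫ s in (0 : ℝ)..(k * dt), P.semiH2 (u₁ s)) +
          dt ^ 2 / 8 * ∫ s in (0 : ℝ)..(k * dt), ‖u₃ s‖) := by
    intro k
    induction k with
    | zero => intro _; simp
    | succ k ih =>
      intro hk
      have hk' : k ≤ M := (Nat.le_succ k).trans hk
      obtain ⟨r1, r2, r3, r4⟩ := hrep k hk'
      obtain ⟨s1, s2, s3, s4⟩ := hrep (k + 1) hk
      have hd : ((k + 1 : ℕ) : ℝ) * dt - k * dt = dt := by push_cast; ring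
      have hlt : (k : ℝ) * dt < (k + 1 : ℕ) * dt := by linarith
      have h0 : (0 : ℝ) ∈ Icc 0 T := ⟨le_rfl, hT.le⟩
      have h := hs.wnorm_step_le hT hN (htk k hk').1 hlt (htk _ hk).2 r2 s2 r1 s1 r3 s3 r4 s4
        (hCN.mem k hk') (hCN.mem _ hk) (by
          intro v hv
          rw [hd]
          exact hCN.step (k + 1) (by omega) hk v hv)
      rw [hd] at h
      have i3 : ∀ a ∈ Icc 0 T, ∀ b ∈ Icc 0 T,
          IntervalIntegrable (fun s => ‖u₃ s‖) volume a b := fun a ha b hb =>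
        hs.deriv_three.1.norm.mono_set (by
          rw [uIcc_of_le hT.le]
          exact uIcc_subset_Icc ha hb)
      rw [← intervalIntegral.integral_add_adjacent_intervals
          (hs.intervalIntegrable_semiH2 h0 (htk k hk'))
          (hs.intervalIntegrable_semiH2 (htk k hk') (htk _ hk)),
        ← intervalIntegral.integral_add_adjacent_intervals (i3 0 h0 _ (htk k hk'))
          (i3 _ (htk k hk') _ (htk _ hk))]
      refine h.trans ((add_le_add (ih hk') le_rfl).trans (le_of_eq ?_))
      ring
  set S := maxUpTo M (fun k => P.semiH2 (u (k * dt))) with hS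
  set J₁ := ∫ s in (0 : ℝ)..T, P.semiH2 (u₁ s) with hJ₁
  set J₂ := ∫ s in (0 : ℝ)..T, P.semiH2 (u₂ s) with hJ₂
  set J₃ := ∫ s in (0 : ℝ)..T, ‖u₃ s‖ with hJ₃
  have hJ₁0 : 0 ≤ J₁ := intervalIntegral.integral_nonneg hT.le fun s _ => semiH2_nonneg _
  have hJ₂0 : 0 ≤ J₂ := intervalIntegral.integral_nonneg hT.le fun s _ => semiH2_nonneg _
  have hJ₃0 : 0 ≤ J₃ := intervalIntegral.integral_nonneg hT.le fun s _ => norm_nonneg _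
  set e₀ := P.l2norm (fun x => u ((0 : ℕ) * dt) x - uh 0 x) with he₀
  have he₀0 : 0 ≤ e₀ := l2norm_nonneg _
  have hint : ∀ k : ℕ, k ≤ M → P.l2norm (fun x => V k x - I k x) ≤ P.rho * P.h N ^ 2 * S := by
    intro k hk
    obtain ⟨r1, r2, r3, r4⟩ := hrep k hk
    obtain ⟨i, hi⟩ := exists_isElementwise hN r3
    refine (r2.l2norm_sub_le hN hi fun j hj => (r4 j hj).symm).trans
      (mul_le_mul_of_nonneg_left ?_ hρ)
    rw [← r2.semiH2_eq r1]
    exact le_maxUpTo (fun k => P.semiH2 (u (k * dt))) hk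
  have hS0 : 0 ≤ S := (semiH2_nonneg _).trans
    (le_maxUpTo (fun k => P.semiH2 (u (k * dt))) (Nat.zero_le M))
  have hmem : ∀ k : ℕ, k ≤ M → MemLp (V k) 2 P.vol ∧ MemLp (I k) 2 P.vol ∧
      MemLp (uh k) 2 P.vol := by
    intro k hk
    obtain ⟨r1, r2, r3, r4⟩ := hrep k hk
    obtain ⟨i, hi⟩ := exists_isElementwise hN r3
    obtain ⟨e, he⟩ := exists_isElementwise hN (hCN.mem k hk)
    exact ⟨r2.hasGrad.memLp_self, hi.hasGrad.memLp_self, he.hasGrad.memLp_self⟩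
  have herr : ∀ k : ℕ, k ≤ M → P.l2norm (fun x => u (k * dt) x - uh k x) =
      P.l2norm (fun x => V k x - uh k x) := by
    intro k hk
    rw [l2norm, l2norm]
    congr 1
    apply eLpNorm_congr_ae
    filter_upwards [(hrep k hk).1] with x hx
    rw [hx]
  -- the initial error
  have hθ₀ : P.l2norm (fun x => I 0 x - uh 0 x) ≤ P.rho * P.h N ^ 2 * S + e₀ := by
    obtain ⟨n1, n2, n3⟩ := hmem 0 (Nat.zero_le M)
    have e1 : (fun x => I 0 x - uh 0 x) = fun x => -(V 0 x - I 0 x) + (V 0 x - uh 0 x) := by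
      ext x; ring
    have hneg : P.l2norm (fun x => -(V 0 x - I 0 x)) = P.l2norm (fun x => V 0 x - I 0 x) := by
      rw [l2norm, l2norm]
      exact congrArg ENNReal.toReal (eLpNorm_neg _ _ _)
    rw [e1, he₀, herr 0 (Nat.zero_le M)]
    exact (l2norm_add_le (n1.sub n2).neg (n1.sub n3)).trans
      (add_le_add (hneg.le.trans (hint 0 (Nat.zero_le M))) le_rfl)
  have hα : P.alpha3 = cm⁻¹ * cM := by rw [alpha3, div_eq_inv_mul]
  have hα1 := P.one_le_alpha3
  have hα4 := P.alpha3_le_alpha4 M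
  have hα5 : 0 ≤ P.alpha5 := div_nonneg (le_max_of_le_left (Real.sqrt_nonneg _)) hcm0.le
  refine Finset.sup'_le _ _ fun k hk => ?_
  have hk' : k ≤ M := Nat.lt_succ_iff.1 (Finset.mem_range.1 hk)
  obtain ⟨n1, n2, n3⟩ := hmem k hk'
  obtain ⟨n1', n2', n3'⟩ := hmem 0 (Nat.zero_le M)
  -- The weighted norm is left only here, after all steps have been summed, so the factor `α₃`
  -- appears once and does not depend on `k`.
  have hθ : P.l2norm (fun x => I k x - uh k x) ≤
      P.alpha3 * ((P.rho * P.h N ^ 2 * S + e₀) + (P.rho * P.h N ^ 2 * J₁ + dt ^ 2 / 8 * J₃)) := by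
    have j1 : ∫ s in (0 : ℝ)..(k * dt), P.semiH2 (u₁ s) ≤ J₁ :=
      intervalIntegral.integral_mono_interval le_rfl (htk k hk').1 (htk k hk').2
        (ae_of_all _ fun s => semiH2_nonneg _) hs.mem_one.2
    have j3 : ∫ s in (0 : ℝ)..(k * dt), ‖u₃ s‖ ≤ J₃ :=
      intervalIntegral.integral_mono_interval le_rfl (htk k hk').1 (htk k hk').2
        (ae_of_all _ fun s => norm_nonneg _) hs.deriv_three.1.norm
    have h1 : P.wnorm (fun x => I k x - uh k x) ≤
        cM * ((P.rho * P.h N ^ 2 * S + e₀) + (P.rho * P.h N ^ 2 * J₁ + dt ^ 2 / 8 * J₃)) := by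
      rw [mul_add]
      refine (hind k hk').trans (add_le_add ((wnorm_le (n2'.sub n3')).trans
        (mul_le_mul_of_nonneg_left hθ₀ hcM0)) (mul_le_mul_of_nonneg_left (add_le_add
          (mul_le_mul_of_nonneg_left j1 hρ) (mul_le_mul_of_nonneg_left j3 (by positivity))) hcM0))
    rw [hα, mul_assoc]
    exact (le_wnorm (n2.sub n3)).trans (mul_le_mul_of_nonneg_left h1 (inv_nonneg.2 hcm0.le))
  have e1 : (fun x => V k x - uh k x) = fun x => (V k x - I k x) + (I k x - uh k x) := by
    ext x; ring
  rw [herr k hk', e1]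
  refine (l2norm_add_le (n1.sub n2) (n2.sub n3)).trans
    ((add_le_add (hint k hk') hθ).trans ?_)
  set R := P.rho * P.h N ^ 2 with hR
  have hRS : 0 ≤ R * S := mul_nonneg hρ hS0
  have hRJ : 0 ≤ R * J₁ := mul_nonneg hρ hJ₁0
  have hdJ : 0 ≤ dt ^ 2 / 8 * J₃ := by positivity
  -- `R * S` occurs twice, from the interpolation error at `t_k` and from the initial discrete
  -- error; this is the constant 2.
  have b1 : R * S ≤ A * (R * S) := le_mul_of_one_le_left hRS (hα1.trans hA)
  have b2 : P.alpha3 * (R * S) ≤ A * (R * S) := mul_le_mul_of_nonneg_right hA hRS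
  have b3 : P.alpha3 * e₀ ≤ A * e₀ := mul_le_mul_of_nonneg_right hA he₀0
  have b4 : P.alpha3 * (R * J₁) ≤ P.alpha4 M * (R * J₁) := mul_le_mul_of_nonneg_right hα4 hRJ
  have b5 : P.alpha3 * (dt ^ 2 / 8 * J₃) ≤ P.alpha4 M * (dt ^ 2 / 8 * J₃) :=
    mul_le_mul_of_nonneg_right hα4 hdJ
  have hα40 : 0 ≤ P.alpha4 M := (zero_le_one.trans hα1).trans hα4
  -- The `α₅` term and the second copy of the `J₁` term are slack, so nonnegativity is enough.
  have b6 : 0 ≤ P.alpha4 M * (dt ^ 2 / 2) * (P.alpha5 * J₂) := by positivity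
  have b7 : 0 ≤ P.alpha4 M * (R * J₁) := mul_nonneg hα40 hRJ
  rw [errorBound]
  calc _ = R * S + P.alpha3 * (R * S) + P.alpha3 * e₀ + P.alpha3 * (R * J₁) +
        P.alpha3 * (dt ^ 2 / 8 * J₃) := by ring
    _ ≤ 2 * (A * (R * S) + P.alpha4 M * (R * J₁)) + P.alpha4 M * (dt ^ 2 / 8 * J₃) +
        P.alpha4 M * (dt ^ 2 / 2) * (P.alpha5 * J₂) + A * e₀ := by linarith
    _ = _ := by rw [hR]; ring

end Data

end InterfaceIFEM

end

theorem mainTheorem2 :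
    ∃ C : ℝ, 0 < C ∧
      ∀ (P : InterfaceIFEM.Data) (T : ℝ) (N M : ℕ), 0 < T → 1 ≤ N → 1 ≤ M →
      ∀ (u u₁ u₂ u₃ : ℝ → P.L2) (uh : ℕ → ℝ → ℝ),
        P.IsWeakSolution T u u₁ u₂ u₃ →
        P.IsCrankNicolson N M (T / M) uh →
        let err : ℕ → ℝ := fun k => P.l2norm (fun x => u (k * (T / M)) x - uh k x)
        InterfaceIFEM.Data.maxUpTo M err
            ≤ P.errorBound C (P.alpha3 ^ M) T N M u u₁ u₂ u₃ (err 0) ∧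
          (1 ≤ T →
            InterfaceIFEM.Data.maxUpTo M err
              ≤ P.errorBound C (P.alpha3 ^ T) T N M u u₁ u₂ u₃ (err 0)) := by
  -- Both powers dominate `α₃` because `α₃ ≥ 1` and the exponents `M` and `T` are at least 1; the
  -- second is a real power.
  refine ⟨2, two_pos, fun P T N M hT hN hM u u₁ u₂ u₃ uh hs hCN => ⟨?_, fun hT1 => ?_⟩⟩
  · exact InterfaceIFEM.Data.maxUpTo_error_le hT hN hM hs hCN
      (le_self_pow₀ InterfaceIFEM.Data.one_le_alpha3 (by omega))
  · refine InterfaceIFEM.Data.maxUpTo_error_le hT hN hM hs hCN ?_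
    have h := Real.rpow_le_rpow_of_exponent_le (InterfaceIFEM.Data.one_le_alpha3 (P := P)) hT1
    rwa [Real.rpow_one] at h
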